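/- A function $f:\{0,1\}^n\to\{0,1\}$ is monotone if $f(x)\le f(y)$ whenever $x_i\le y_i$ for all $i$, and $\varepsilon$-far from monotone if it differs from every monotone $g:\{0,1\}^n\to\{0,1\}$ on at least $\varepsilon 2^n$ points. A $q$-query (two-sided error, adaptive) $\varepsilon$-tester for monotonicity on $\{0,1\}^n$ is a randomized algorithm that makes at most $q$ adaptive queries to the values of an unknown $f:\{0,1\}^n\to\{0,1\}$, accepts with probability at least $2/3$ whenever $f$ is monotone, and rejects with probability at least $2/3$ whenever $f$ is $\varepsilon$-far from monotone. (1) For every constant $c>0$ there are constants $\varepsilon_c>0$, $C>0$ and $n_0$ such that for every $n\ge n_0$, every $q$-query $\varepsilon_c$-tester for monotonicity on $\{0,1\}^n$ satisfies $q\ge C\,n^{1/2-c}$. That is, $\Omega(n^{1/2-c})$ queries are necessary. (2) For every integer $\ell\ge 1$ there are constants $\varepsilon_\ell>0$, $C>0$, $k\in\mathbb{N}$ and $n_0$ such that for every $n\ge n_0$, every $q$-query $\varepsilon_\ell$-tester for monotonicity on $\{0,1\}^n$ satisfies $q\ge C\,n^{1/2-1/(4\ell+2)}/(\log n)^k$.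 That is, $\tilde\Omega\big(n^{1/2-1/(4\ell+2)}\big)$ queries are necessary. -/

import Mathlib

open scoped ENNReal

/-- A Boolean function `f : {0,1}^n → {0,1}`. The cube carries the coordinatewise order and
`false ≤ true`, so that `Monotone f` is the usual monotonicity of Boolean functions. -/
abbrev BoolFun (n : ℕ) : Type := (Fin n → Bool) → Bool

/-- `f` is `ε`-far from monotone: it disagrees with every monotone Boolean function on at least
`ε * 2 ^ n` points of the cube. -/
def FarFromMonotone {n : ℕ} (ε : ℝ) (f : BoolFun n) : Prop :=
  ∀ g : BoolFun n, Monotone g → ε * 2 ^ n ≤ (hammingDist f g : ℝ)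

/-- A deterministic adaptive algorithm with membership-query access to a Boolean function on `n`
variables: it either halts with an output (`true` means accept), or queries a point `x` and
continues with an algorithm that depends on the answer received. -/
inductive DetAlg (n : ℕ) : Type where
  | halt (output : Bool) : DetAlg n
  | query (x : Fin n → Bool) (next : Bool → DetAlg n) : DetAlg n

namespace DetAlg

/-- The output of the algorithm when its queries are answered by `f`. -/
def output {n : ℕ} (f : BoolFun n) : DetAlg n → Bool
  | halt b => b
  | query x next => output f (next (f x))

/-- The number of queries made by the algorithm when its queries are answered by `f`. -/
def numQueries {n : ℕ} (f : BoolFun n) : DetAlg n → ℕ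
  | halt _ => 0
  | query x next => numQueries f (next (f x)) + 1

end DetAlg

/-- A randomized adaptive algorithm: a probability distribution over deterministic ones. -/
abbrev RandAlg (n : ℕ) : Type := PMF (DetAlg n)

namespace RandAlg

/-- The probability that the algorithm, run on `f`, outputs `b`. -/
noncomputable def outputProb {n : ℕ} (A : RandAlg n) (f : BoolFun n) (b : Bool) : ℝ≥0∞ :=
  (A.map (DetAlg.output f)) b

/-- The algorithm makes at most `q` queries, on every input function and for every outcome of
its randomness. -/
def MakesAtMost {n : ℕ} (A : RandAlg n) (q : ℕ) : Prop :=
  ∀ T ∈ A.support, ∀ f : BoolFun n, T.numQueries f ≤ q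

/-- The algorithm is an `ε`-tester for monotonicity with two-sided error: it accepts every
monotone function with probability at least `2/3`, and rejects every function that is `ε`-far
from monotone with probability at least `2/3`. -/
def IsMonotonicityTester {n : ℕ} (A : RandAlg n) (ε : ℝ) : Prop :=
  (∀ f : BoolFun n, Monotone f → 2 / 3 ≤ outputProb A f true) ∧
  (∀ f : BoolFun n, FarFromMonotone ε f → 2 / 3 ≤ outputProb A f false)

end RandAlg

/-! The hard instances live on a tree of depth L whose edges carry random terms (at even depth) or
clauses (at odd depth), each coordinate being included with probability 1/M, where M is about √n. A
point of the middle layers descends as long as exactly one child is hit. No hit or several hits fix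
the value in a way compatible with monotonicity. The monotone instances have random constant leaves.
The others put `x k ^^ x k'`, plus a random bit, at each leaf, which decreases along an edge of
every {k, k'}-square inside one leaf, whatever the bit (`farFromMonotone_noFn`). On average a
positive fraction of the squares lies in single leaves (`sum_card_goodBase_ge`, `exists_width`).

A deterministic algorithm separates the two families only if two queried points in a common leaf
differ at k or k' (`card_yes_le_card_no`). As k is uniform and k' is its cyclic successor, it
suffices that o(n) coordinates on average vary within leaves. Two facts give this. Probabilistic:
take a hierarchy of partitions of the queried points in which the points split off from a class miss
more than s of its common coordinates. Resampling a single term on these coordinates shows that,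
outside an unlikely event `Bad`, points sharing a node share a class (`card_bad_le`,
`label_eq_of_reach`). Combinatorial: such a hierarchy exists with classes having many common
coordinates (`exists_chain`). Since terms and clauses alternate, a pigeonhole on class sizes for q ≤
t^L points leaves only O(L t (√n + s) q) varying coordinates (`card_varied_le`).

With s = M t and t about n^a, a = (1/2 - c)/L, this is of order n^(1 - (c - 2a)) for q < n^(1/2 -
c), and L > 1/c makes c > 2a. Averaging over the instances (`card_le_of_tester`) excludes testers.
Part (2) is part (1) at c = 1/(4ℓ+2): since ε may depend on ℓ, no logarithm is lost. -/

namespace Talagrand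

open Finset

/-! ### Multilevel Talagrand functions -/

/-- The coordinates on which `x` takes the value `p`. -/
def agree {n : ℕ} (p : Bool) (x : Fin n → Bool) : Finset (Fin n) := univ.filter (fun a => x a = p)

/-- The set encoded by `g` (the zeros of `g`) is contained in the set where `x` equals `p`:
the term is satisfied (`p = true`) or the clause is falsified (`p = false`). -/
def Hit {n M : ℕ} [NeZero M] (p : Bool) (g : Fin n → Fin M) (x : Fin n → Bool) : Prop :=
  ∀ a, g a = 0 → x a = p

/-- Levels alternate between terms (`true`) and clauses (`false`). -/
def pol (d : ℕ) : Bool := decide (Even d)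

/-- An encoding of lists of length at most `L` by a finite type. -/
def enc {N : ℕ} (L : ℕ) (u : List (Fin N)) : Fin L → Option (Fin N) := fun d => u[(d : ℕ)]?

theorem enc_injOn {N L : ℕ} {u v : List (Fin N)} (hu : u.length ≤ L) (hv : v.length ≤ L)
    (h : enc L u = enc L v) : u = v := by
  apply List.ext_getElem?
  intro i
  by_cases hi : i < L
  · exact congrFun h ⟨i, hi⟩
  · rw [List.getElem?_eq_none (by omega), List.getElem?_eq_none (by omega)]

/-- A choice of all terms and clauses. -/
abbrev Terms (n M N L : ℕ) : Type := (Fin L → Option (Fin N)) → Fin n → Fin M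

section

variable {n M N L : ℕ} [NeZero M]

open Classical in
/-- The children of the node `u` whose term is satisfied (or clause is falsified) by `x`. -/
noncomputable def hits (τ : Terms n M N L) (u : List (Fin N)) (x : Fin n → Bool) :
    Finset (Fin N) :=
  univ.filter (fun i => Hit (pol u.length) (τ (enc L (i :: u))) x)

theorem mem_hits {τ : Terms n M N L} {u : List (Fin N)} {x : Fin n → Bool} {i : Fin N} :
    i ∈ hits τ u x ↔ Hit (pol u.length) (τ (enc L (i :: u))) x := by
  simp [hits]

open Classical in
/-- Descend `d` levels from the node `u`: either stop with a value or reach a node. -/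
noncomputable def out (τ : Terms n M N L) (x : Fin n → Bool) :
    ℕ → List (Fin N) → Bool ⊕ List (Fin N)
  | 0, u => Sum.inr u
  | d + 1, u =>
    if h : ∃ i, hits τ u x = {i} then out τ x d (h.choose :: u)
    -- At a term level no hit gives false and several give true; at a clause level it is the
    -- reverse.
    else Sum.inl (if hits τ u x = ∅ then !pol u.length else pol u.length)

theorem out_succ_of_singleton {τ : Terms n M N L} {x : Fin n → Bool} {u : List (Fin N)} {i : Fin N}
    (h : hits τ u x = {i}) (d : ℕ) : out τ x (d + 1) u = out τ x d (i :: u) := by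
  have h' : ∃ i, hits τ u x = {i} := ⟨i, h⟩
  have : h'.choose = i := by
    exact singleton_injective (h'.choose_spec.symm.trans h)
  rw [out, dif_pos h', this]

theorem out_succ_of_not {τ : Terms n M N L} {x : Fin n → Bool} {u : List (Fin N)}
    (h : ¬ ∃ i, hits τ u x = {i}) (d : ℕ) :
    out τ x (d + 1) u = Sum.inl (if hits τ u x = ∅ then !pol u.length else pol u.length) := by
  classical
  rw [out, dif_neg h]

/-- The node `u` lies on the path of `x`. -/
def Reach (τ : Terms n M N L) (x : Fin n → Bool) : List (Fin N) → Prop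
  | [] => True
  | i :: u => Reach τ x u ∧ hits τ u x = {i}

theorem out_eq_inr {τ : Terms n M N L} {x : Fin n → Bool} {d : ℕ} {u w : List (Fin N)}
    (hu : Reach τ x u) (h : out τ x d u = Sum.inr w) :
    Reach τ x w ∧ w.length = u.length + d := by
  induction d generalizing u with
  | zero =>
    simp only [out, Sum.inr.injEq] at h
    subst h
    exact ⟨hu, rfl⟩
  | succ d ih =>
    by_cases hs : ∃ i, hits τ u x = {i}
    · obtain ⟨i, hi⟩ := hs
      rw [out_succ_of_singleton hi] at h
      have := ih (u := i :: u) ⟨hu, hi⟩ h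
      refine ⟨this.1, ?_⟩
      rw [this.2, List.length_cons]
      omega
    · rw [out_succ_of_not hs] at h
      simp at h

theorem reach_unique {τ : Terms n M N L} {x : Fin n → Bool} {u v : List (Fin N)}
    (hu : Reach τ x u) (hv : Reach τ x v) (h : u.length = v.length) : u = v := by
  induction u generalizing v with
  | nil => exact (List.length_eq_zero_iff.1 h.symm).symm
  | cons i u ih =>
    cases v with
    | nil => simp at h
    | cons j v =>
      obtain rfl := ih hu.1 hv.1 (by simpa using h)
      have := hu.2.symm.trans hv.2
      rw [singleton_injective this]

/-- The Boolean function with the terms `τ` and the values `v` at the leaves. -/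
noncomputable def fn (lo : ℕ) (τ : Terms n M N L) (v : List (Fin N) → (Fin n → Bool) → Bool) :
    BoolFun n := fun x =>
  if (agree true x).card < lo then false
  else if n - lo < (agree true x).card then true
  else Sum.elim id (fun w => v w x) (out τ x L [])

theorem agree_true_subset {x y : Fin n → Bool} (h : x ≤ y) : agree true x ⊆ agree true y := by
  intro a
  simp only [agree, mem_filter, mem_univ, true_and]
  intro ha
  have := h a
  rw [ha] at this
  exact Bool.eq_true_of_true_le this

theorem hits_mono_of_true {τ : Terms n M N L} {u : List (Fin N)} {x y : Fin n → Bool}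
    (h : x ≤ y) (hp : pol u.length = true) : hits τ u x ⊆ hits τ u y := by
  intro i
  rw [mem_hits, mem_hits, hp]
  intro hi a ha
  have h1 := h a
  rw [hi a ha] at h1
  exact Bool.eq_true_of_true_le h1

theorem hits_mono_of_false {τ : Terms n M N L} {u : List (Fin N)} {x y : Fin n → Bool}
    (h : x ≤ y) (hp : pol u.length = false) : hits τ u y ⊆ hits τ u x := by
  intro i
  rw [mem_hits, mem_hits, hp]
  intro hi a ha
  have h1 := h a
  rw [hi a ha] at h1
  exact Bool.eq_false_of_le_false h1

/-- Moving up the cube, hit sets grow at term levels and shrink at clause levels. The cases none,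
one, several are therefore passed in an order that never lowers the value, and two comparable
singletons name the same child. -/
theorem out_le_out {τ : Terms n M N L} (b : List (Fin N) → Bool) {x y : Fin n → Bool} (h : x ≤ y)
    (d : ℕ) (u : List (Fin N)) :
    Sum.elim id b (out τ x d u) ≤ Sum.elim id b (out τ y d u) := by
  induction d generalizing u with
  | zero => simp [out]
  | succ d ih =>
    cases hp : pol u.length
    · have hs := hits_mono_of_false (τ := τ) h hp
      by_cases hy : ∃ i, hits τ u y = {i}
      · obtain ⟨i, hi⟩ := hy
        by_cases hx : ∃ j, hits τ u x = {j}
        · obtain ⟨j, hj⟩ := hx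
          rw [hi, hj, singleton_subset_singleton] at hs
          subst hs
          rw [out_succ_of_singleton hi, out_succ_of_singleton hj]
          exact ih _
        · have hne : hits τ u x ≠ ∅ := by
            intro he
            rw [he, hi] at hs
            simp at hs
          rw [out_succ_of_not hx, if_neg hne, hp]
          simp
      · by_cases he : hits τ u y = ∅
        · rw [out_succ_of_not hy, if_pos he, hp]
          simp
        · have hx : ¬ ∃ j, hits τ u x = {j} := by
            rintro ⟨j, hj⟩
            rw [hj, subset_singleton_iff] at hs
            exact hs.elim he fun hs => hy ⟨j, hs⟩
          have hne : hits τ u x ≠ ∅ := by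
            intro h0
            rw [h0, subset_empty] at hs
            exact he hs
          rw [out_succ_of_not hx, if_neg hne, hp]
          simp
    · have hs := hits_mono_of_true (τ := τ) h hp
      by_cases hx : ∃ i, hits τ u x = {i}
      · obtain ⟨i, hi⟩ := hx
        by_cases hy : ∃ j, hits τ u y = {j}
        · obtain ⟨j, hj⟩ := hy
          rw [hi, hj, singleton_subset_singleton] at hs
          subst hs
          rw [out_succ_of_singleton hi, out_succ_of_singleton hj]
          exact ih _
        · have hne : hits τ u y ≠ ∅ := by
            intro he
            rw [he, hi] at hs
            simp at hs
          rw [out_succ_of_not hy, if_neg hne, hp]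
          simp
      · by_cases he : hits τ u x = ∅
        · rw [out_succ_of_not hx, if_pos he, hp]
          simp
        · have hy : ¬ ∃ j, hits τ u y = {j} := by
            rintro ⟨j, hj⟩
            rw [hj, subset_singleton_iff] at hs
            exact hs.elim he fun hs => hx ⟨j, hs⟩
          have hne : hits τ u y ≠ ∅ := by
            intro h0
            rw [h0, subset_empty] at hs
            exact he hs
          rw [out_succ_of_not hy, if_neg hne, hp]
          simp

theorem monotone_fn {lo : ℕ} (τ : Terms n M N L) (b : List (Fin N) → Bool) :
    Monotone (fn lo τ fun w _ => b w) := by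
  intro x y h
  have hc := card_le_card (agree_true_subset h)
  simp only [fn]
  by_cases h1 : (agree true x).card < lo
  · simp [h1]
  · have h2 : ¬ (agree true y).card < lo := by omega
    rw [if_neg h1, if_neg h2]
    by_cases h3 : n - lo < (agree true x).card
    · rw [if_pos h3, if_pos (by omega)]
    · rw [if_neg h3]
      split_ifs
      · exact Bool.le_true _
      · exact out_le_out b h L []

/-- Changing the term of one edge does not change the outcome at `x` if it does not change the hits,
or leaves at least two of them. -/
theorem out_congr {τ τ' : Terms n M N L} {x : Fin n → Bool} {u₀ : List (Fin N)} {i₀ : Fin N}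
    (hu₀ : u₀.length < L) (hne : ∀ e, e ≠ enc L (i₀ :: u₀) → τ' e = τ e)
    (hx : Reach τ x u₀ → hits τ' u₀ x = hits τ u₀ x ∨
      (2 ≤ (hits τ u₀ x).card ∧ 2 ≤ (hits τ' u₀ x).card))
    (d : ℕ) (u : List (Fin N)) (hd : u.length + d = L) (hu : Reach τ x u) :
    out τ' x d u = out τ x d u := by
  induction d generalizing u with
  | zero => rfl
  | succ d ih =>
    have key : hits τ' u x = hits τ u x ∨
      (2 ≤ (hits τ u x).card ∧ 2 ≤ (hits τ' u x).card) := by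
      by_cases h : u = u₀
      · subst h; exact hx hu
      · left
        ext i
        rw [mem_hits, mem_hits, hne]
        intro he
        have := enc_injOn (by simp; omega) (by simp; omega) he
        exact h (List.cons.inj this).2
    rcases key with h | ⟨h1, h2⟩
    · by_cases hs : ∃ i, hits τ u x = {i}
      · obtain ⟨i, hi⟩ := hs
        rw [out_succ_of_singleton hi, out_succ_of_singleton (h.trans hi)]
        exact ih _ (by simp; omega) ⟨hu, hi⟩
      · rw [out_succ_of_not hs, out_succ_of_not (by rw [h]; exact hs), h]
    · have a1 : ¬ ∃ i, hits τ u x = {i} := by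
        rintro ⟨i, hi⟩; rw [hi] at h1; simp at h1
      have a2 : ¬ ∃ i, hits τ' u x = {i} := by
        rintro ⟨i, hi⟩; rw [hi] at h2; simp at h2
      have b1 : hits τ u x ≠ ∅ := by
        intro h; rw [h] at h1; simp at h1
      have b2 : hits τ' u x ≠ ∅ := by
        intro h; rw [h] at h2; simp at h2
      rw [out_succ_of_not a1, out_succ_of_not a2, if_neg b1, if_neg b2]

theorem fn_congr {lo : ℕ} {τ τ' : Terms n M N L} {v v' : List (Fin N) → (Fin n → Bool) → Bool}
    {x : Fin n → Bool} (h : out τ' x L [] = out τ x L [])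
    (hv : ∀ w, out τ x L [] = Sum.inr w → v' w x = v w x) : fn lo τ' v' x = fn lo τ v x := by
  simp only [fn, h]
  split_ifs
  · rfl
  · rfl
  · cases hw : out τ x L [] with
    | inl c => rfl
    | inr w => exact hv w hw

/-- `x` lies in the middle layers. -/
def Middle (lo : ℕ) (x : Fin n → Bool) : Prop :=
  lo ≤ (agree true x).card ∧ (agree true x).card ≤ n - lo

theorem fn_eq_of_not_middle {lo : ℕ} {τ τ' : Terms n M N L}
    {v v' : List (Fin N) → (Fin n → Bool) → Bool} {x : Fin n → Bool} (h : ¬ Middle lo x) :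
    fn lo τ v x = fn lo τ' v' x := by
  simp only [fn, Middle, not_and_or, not_le] at *
  rcases h with h | h
  · simp [h]
  · simp [h]

theorem fn_of_middle {lo : ℕ} {τ : Terms n M N L} {v : List (Fin N) → (Fin n → Bool) → Bool}
    {x : Fin n → Bool} (h : Middle lo x) :
    fn lo τ v x = Sum.elim id (fun w => v w x) (out τ x L []) := by
  rw [fn, if_neg (not_lt.2 h.1), if_neg (not_lt.2 h.2)]

end

/-! ### Clusters of points in the middle layers -/

section

variable {n : ℕ}

/-- The members of `X` with the same label as `x`. -/
def cls (X : Finset (Fin n → Bool)) (κ : (Fin n → Bool) → Fin n → Bool) (x : Fin n → Bool) :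
    Finset (Fin n → Bool) :=
  X.filter (fun y => κ y = κ x)

/-- The coordinates on which all members of `c` take the value `p`. -/
def common (p : Bool) (c : Finset (Fin n → Bool)) : Finset (Fin n) :=
  univ.filter (fun a => ∀ x ∈ c, x a = p)

/-- The coordinates on which some two members of `c` differ. -/
def vary (c : Finset (Fin n → Bool)) : Finset (Fin n) :=
  univ.filter (fun a => ∃ x ∈ c, ∃ y ∈ c, x a ≠ y a)

theorem common_anti {p : Bool} {c c' : Finset (Fin n → Bool)} (h : c ⊆ c') :
    common p c' ⊆ common p c := by
  intro a
  simp only [common, mem_filter, mem_univ, true_and]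
  exact fun ha x hx => ha x (h hx)

theorem mem_cls_self {X : Finset (Fin n → Bool)} {κ : (Fin n → Bool) → Fin n → Bool}
    {x : Fin n → Bool} (hx : x ∈ X) : x ∈ cls X κ x := by
  simp [cls, hx]

/-- A hierarchy of partitions of `X`. Within a class at depth `d`, the points outside a given
class at depth `d + 1` are far from the common coordinates of that class. -/
structure Chain (L s : ℕ) (X : Finset (Fin n → Bool))
    (κ : ℕ → (Fin n → Bool) → Fin n → Bool) : Prop where
  base : ∀ x y, κ 0 x = κ 0 y
  refine : ∀ d x y, κ (d + 1) x = κ (d + 1) y → κ d x = κ d y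
  stable : ∀ d < L, ∀ x ∈ X, ∀ z ∈ X, κ d x = κ d z → κ (d + 1) x ≠ κ (d + 1) z →
    s < ((common (pol d) (cls X (κ (d + 1)) x)).filter (fun a => z a ≠ pol d)).card

theorem Chain.mono {L s : ℕ} {X X' : Finset (Fin n → Bool)}
    {κ : ℕ → (Fin n → Bool) → Fin n → Bool} (h : Chain L s X κ) (hX : X' ⊆ X) :
    Chain L s X' κ where
  base := h.base
  refine := h.refine
  stable d hd x hx z hz h1 h2 :=
    (h.stable d hd x (hX hx) z (hX hz) h1 h2).trans_le
      (card_le_card (filter_subset_filter _ (common_anti (filter_subset_filter _ hX))))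

/-- Start from singletons and merge two classes that violate the last property, until none do. The
defect hi + s - |common| is at most σ for a singleton and subadditive under merging: apart from at
most s of them, the common coordinates of the class of x lie, like those of the class of z, in
`agree p z`, a set of size at most hi. -/
theorem exists_stable_refinement {X : Finset (Fin n → Bool)} {p : Bool} {lo hi s σ : ℕ}
    (hlo : ∀ x ∈ X, lo ≤ (agree p x).card) (hhi : ∀ x ∈ X, (agree p x).card ≤ hi)
    (hσ : hi + s ≤ lo + σ) (κ₀ : (Fin n → Bool) → Fin n → Bool) :
    ∃ κ : (Fin n → Bool) → Fin n → Bool, (∀ x y, κ x = κ y → κ₀ x = κ₀ y) ∧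
      (∀ x ∈ X, hi + s ≤ (common p (cls X κ x)).card + (cls X κ x).card * σ) ∧
      (∀ x ∈ X, ∀ z ∈ X, κ₀ x = κ₀ z → κ x ≠ κ z →
        s < ((common p (cls X κ x)).filter (fun a => z a ≠ p)).card) := by
  suffices H : ∀ k : ℕ, ∀ κ : (Fin n → Bool) → Fin n → Bool, (X.image κ).card = k →
      (∀ x y, κ x = κ y → κ₀ x = κ₀ y) →
      (∀ x ∈ X, hi + s ≤ (common p (cls X κ x)).card + (cls X κ x).card * σ) →
      ∃ κ : (Fin n → Bool) → Fin n → Bool, (∀ x y, κ x = κ y → κ₀ x = κ₀ y) ∧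
      (∀ x ∈ X, hi + s ≤ (common p (cls X κ x)).card + (cls X κ x).card * σ) ∧
      (∀ x ∈ X, ∀ z ∈ X, κ₀ x = κ₀ z → κ x ≠ κ z →
        s < ((common p (cls X κ x)).filter (fun a => z a ≠ p)).card) by
    refine H _ id rfl (fun x y h => congrArg κ₀ h) fun x hx => ?_
    have h1 : cls X id x = {x} := by
      ext y
      simp only [cls, id, mem_filter, mem_singleton]
      exact ⟨fun h => h.2, fun h => ⟨h ▸ hx, h⟩⟩
    have h2 : common p {x} = agree p x := by
      ext a; simp [common, agree]
    rw [h1, h2, card_singleton, one_mul]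
    exact hσ.trans (Nat.add_le_add_right (hlo x hx) σ)
  intro k
  induction k using Nat.strong_induction_on with
  | _ k ih =>
  intro κ hk href hinv
  by_cases hst : ∀ x ∈ X, ∀ z ∈ X, κ₀ x = κ₀ z → κ x ≠ κ z →
        s < ((common p (cls X κ x)).filter (fun a => z a ≠ p)).card
  · exact ⟨κ, href, hinv, hst⟩
  push Not at hst
  obtain ⟨x, hx, z, hz, h0, hne, hle⟩ := hst
  let κ' : (Fin n → Bool) → Fin n → Bool := fun y => if κ y = κ z then κ x else κ y
  have hcl : ∀ y, κ y = κ x ∨ κ y = κ z → cls X κ' y = cls X κ x ∪ cls X κ z := by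
    intro y hy
    have hy' : κ' y = κ x := by
      simp only [κ']
      split_ifs with h
      · rfl
      · exact hy.resolve_right h
    ext w
    simp only [cls, mem_union, mem_filter, hy', ← and_or_left]
    refine and_congr_right fun _ => ?_
    simp only [κ']
    split_ifs with h
    · simp [h]
    · simp [h]
  have hcl' : ∀ y, κ y ≠ κ x → κ y ≠ κ z → cls X κ' y = cls X κ y := by
    intro y h1 h2
    ext w
    simp only [cls, mem_filter]
    refine and_congr_right fun _ => ?_
    simp only [κ', if_neg h2]
    split_ifs with h
    · rw [h]; exact ⟨fun h => absurd h.symm h1, fun h => absurd h.symm h2⟩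
    · rfl
  refine ih (X.image κ').card ?_ κ' rfl ?_ ?_
  · rw [← hk]
    refine card_lt_card ⟨?_, ?_⟩
    · intro w hw
      obtain ⟨y, hy, rfl⟩ := mem_image.1 hw
      simp only [κ']
      split_ifs
      · exact mem_image_of_mem _ hx
      · exact mem_image_of_mem _ hy
    · intro hsub
      obtain ⟨y, hy, hyz⟩ := mem_image.1 (hsub (mem_image_of_mem κ hz))
      simp only [κ'] at hyz
      split_ifs at hyz with h
      · exact hne hyz
      · exact h hyz
  · intro y w hyw
    simp only [κ'] at hyw
    split_ifs at hyw with h1 h2 h2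
    · exact (href _ _ h1).trans (href _ _ h2).symm
    · exact ((href _ _ h1).trans h0.symm).trans (href _ _ hyw)
    · exact ((href _ _ hyw).trans h0).trans (href _ _ h2).symm
    · exact href _ _ hyw
  · intro y hy
    by_cases hyy : κ y = κ x ∨ κ y = κ z
    · rw [hcl y hyy]
      have hdisj : Disjoint (cls X κ x) (cls X κ z) := by
        rw [disjoint_left]
        intro w hw hw'
        exact hne ((mem_filter.1 hw).2.symm.trans (mem_filter.1 hw').2)
      rw [card_union_of_disjoint hdisj]
      have hcom : common p (cls X κ x ∪ cls X κ z)
          = common p (cls X κ x) ∩ common p (cls X κ z) := by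
        ext a
        simp only [common, mem_union, mem_inter, mem_filter, mem_univ, true_and]
        exact ⟨fun h => ⟨fun w hw => h w (Or.inl hw), fun w hw => h w (Or.inr hw)⟩,
          fun h w hw => hw.elim (h.1 w) (h.2 w)⟩
      rw [hcom]
      have e1 := hinv x hx
      have e2 := hinv z hz
      have e3 := card_filter_add_card_filter_not (s := common p (cls X κ x))
        (fun a => z a ≠ p)
      set P := (common p (cls X κ x)).filter (fun a => ¬ z a ≠ p) with hP
      have e4 : (P ∪ common p (cls X κ z)).card ≤ hi := by
        refine (card_le_card ?_).trans (hhi z hz)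
        intro a ha
        simp only [agree, mem_filter, mem_univ, true_and]
        rcases mem_union.1 ha with ha | ha
        · simpa using (mem_filter.1 ha).2
        · exact (mem_filter.1 ha).2 z (mem_cls_self hz)
      have e5 := card_union_add_card_inter P (common p (cls X κ z))
      have e6 : (P ∩ common p (cls X κ z)).card ≤
          (common p (cls X κ x) ∩ common p (cls X κ z)).card :=
        card_le_card (inter_subset_inter_right (filter_subset _ _))
      rw [add_mul]
      omega
    · push Not at hyy
      rw [hcl' y hyy.1 hyy.2]
      exact hinv y hy

theorem exists_chain {X : Finset (Fin n → Bool)} {lo hi s σ : ℕ} (L : ℕ)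
    (hlo : ∀ p, ∀ x ∈ X, lo ≤ (agree p x).card) (hhi : ∀ p, ∀ x ∈ X, (agree p x).card ≤ hi)
    (hσ : hi + s ≤ lo + σ) :
    ∃ κ : ℕ → (Fin n → Bool) → Fin n → Bool, Chain L s X κ ∧
      ∀ d, ∀ x ∈ X, hi + s ≤
        (common (pol d) (cls X (κ (d + 1)) x)).card + (cls X (κ (d + 1)) x).card * σ := by
  choose f hf1 hf2 hf3 using fun (p : Bool) (κ₀ : (Fin n → Bool) → Fin n → Bool) =>
    exists_stable_refinement (hlo p) (hhi p) hσ κ₀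
  let κ : ℕ → (Fin n → Bool) → Fin n → Bool :=
    Nat.rec (fun _ _ => true) (fun d κ₀ => f (pol d) κ₀)
  exact ⟨κ, ⟨fun _ _ => rfl, fun d => hf1 (pol d) (κ d), fun d _ => hf3 (pol d) (κ d)⟩,
    fun d => hf2 (pol d) (κ d)⟩

/-! ### Counting the coordinates that vary within classes -/

theorem card_biUnion_vary_le {X Y : Finset (Fin n → Bool)} (hY : Y ⊆ X)
    (κ : (Fin n → Bool) → Fin n → Bool) (K : ℕ)
    (h : ∀ x ∈ Y, (vary (cls X κ x)).card ≤ K * (cls X κ x).card) :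
    (Y.biUnion fun x => vary (cls X κ x)).card ≤ K * X.card := by
  classical
  have h1 : (Y.biUnion fun x => vary (cls X κ x)) =
      (Y.image κ).biUnion fun l => vary (X.filter fun y => κ y = l) := by
    rw [image_biUnion]
    rfl
  rw [h1]
  calc _ ≤ ∑ l ∈ Y.image κ, (vary (X.filter fun y => κ y = l)).card := card_biUnion_le
    _ ≤ ∑ l ∈ Y.image κ, K * (X.filter fun y => κ y = l).card := by
        refine sum_le_sum fun l hl => ?_
        obtain ⟨x, hx, rfl⟩ := mem_image.1 hl
        exact h x hx
    _ ≤ ∑ l ∈ X.image κ, K * (X.filter fun y => κ y = l).card :=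
        sum_le_sum_of_subset (image_subset_image hY)
    _ = K * X.card := by
        rw [← mul_sum, ← card_eq_sum_card_image]

theorem card_vary_add_le (c : Finset (Fin n → Bool)) (hc : c.Nonempty) (p : Bool) :
    (vary c).card + ((common p c).card + (common (!p) c).card) ≤ n := by
  obtain ⟨x₀, hx₀⟩ := hc
  have d1 : Disjoint (common p c) (common (!p) c) := by
    rw [disjoint_left]
    intro a h1 h2
    have h1 := (mem_filter.1 h1).2 x₀ hx₀
    have h2 := (mem_filter.1 h2).2 x₀ hx₀
    rw [h1] at h2
    cases p <;> simp at h2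
  have d2 : Disjoint (vary c) (common p c ∪ common (!p) c) := by
    rw [disjoint_left]
    intro a h1 h2
    obtain ⟨x, hx, y, hy, hxy⟩ := (mem_filter.1 h1).2
    rcases mem_union.1 h2 with h2 | h2
    · exact hxy (((mem_filter.1 h2).2 x hx).trans ((mem_filter.1 h2).2 y hy).symm)
    · exact hxy (((mem_filter.1 h2).2 x hx).trans ((mem_filter.1 h2).2 y hy).symm)
  rw [← card_union_of_disjoint d1, ← card_union_of_disjoint d2]
  simpa using card_le_univ (vary c ∪ (common p c ∪ common (!p) c))

/-- A varying coordinate is a non-common one of `agree p x` for some member x, and each member has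
at most |c|σ of these. The bound is quadratic in |c|, so it serves only for small classes. -/
theorem card_vary_le {c : Finset (Fin n → Bool)} {p : Bool} {hi σ : ℕ}
    (hhi : ∀ x ∈ c, (agree p x).card ≤ hi) (h : hi ≤ (common p c).card + c.card * σ) :
    (vary c).card ≤ c.card * σ * c.card := by
  classical
  have hsub : vary c ⊆ c.biUnion fun x => agree p x \ common p c := by
    intro a ha
    obtain ⟨x, hx, y, hy, hxy⟩ := (mem_filter.1 ha).2
    have hnc : a ∉ common p c := by
      intro h
      exact hxy (((mem_filter.1 h).2 x hx).trans ((mem_filter.1 h).2 y hy).symm)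
    rw [mem_biUnion]
    by_cases hxp : x a = p
    · exact ⟨x, hx, mem_sdiff.2 ⟨by simp [agree, hxp], hnc⟩⟩
    · refine ⟨y, hy, mem_sdiff.2 ⟨?_, hnc⟩⟩
      simp only [agree, mem_filter, mem_univ, true_and]
      revert hxp hxy
      cases x a <;> cases y a <;> cases p <;> simp
  refine (card_le_card hsub).trans ((card_biUnion_le_card_mul _ _ (c.card * σ) ?_).trans
    (by rw [mul_comm]))
  intro x hx
  have hs : common p c ⊆ agree p x := by
    intro a ha
    simpa [agree] using (mem_filter.1 ha).2 x hx
  rw [card_sdiff_of_subset hs]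
  have := hhi x hx
  omega

theorem pol_succ (d : ℕ) : pol (d + 1) = !pol d := by
  unfold pol
  by_cases h : Even d
  · simp [h, Nat.even_add_one]
  · simp [h, Nat.even_add_one]

/-- Few coordinates vary within the finest classes of a hierarchy. -/
theorem card_varied_le {X : Finset (Fin n → Bool)} {lo s σ t L : ℕ} (hL : 1 ≤ L)
    (hn : 2 * lo ≤ n) (hhi : ∀ p, ∀ x ∈ X, (agree p x).card ≤ n - lo)
    (hX : X.card ≤ t ^ L) {κ : ℕ → (Fin n → Bool) → Fin n → Bool} (hκ : Chain L s X κ)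
    (hinv : ∀ d, ∀ x ∈ X, n - lo + s ≤
        (common (pol d) (cls X (κ (d + 1)) x)).card + (cls X (κ (d + 1)) x).card * σ) :
    (univ.filter fun a => ∃ x ∈ X, ∃ y ∈ X, κ L x = κ L y ∧ x a ≠ y a).card ≤
      L * (2 * t * σ * X.card) := by
  classical
  let m : ℕ → (Fin n → Bool) → ℕ := fun d x => (cls X (κ d) x).card
  -- Pigeonhole along the class sizes of x: they start at most t^L, so either the class at depth L
  -- has at most t members (index 0) or for some 1 ≤ d < L the size drops by a factor at most t from
  -- depth d to d + 1 (index d). `e d` is the depth of the class charged in that case.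
  let Y : ℕ → Finset (Fin n → Bool) := fun d =>
    if d = 0 then X.filter fun x => m L x ≤ t
    else X.filter fun x => m d x ≤ t * m (d + 1) x
  let e : ℕ → ℕ := fun d => if d = 0 then L else d + 1
  have hmpos : ∀ d, ∀ x ∈ X, 0 < m d x := fun d x hx => card_pos.2 ⟨x, mem_cls_self hx⟩
  have hrefine : ∀ d j x y, κ (d + j) x = κ (d + j) y → κ d x = κ d y := by
    intro d j
    induction j with
    | zero => exact fun x y h => h
    | succ j ih => exact fun x y h => ih x y (hκ.refine _ _ _ h)
  have hmono : ∀ d x, cls X (κ (d + 1)) x ⊆ cls X (κ d) x := by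
    intro d x y hy
    rw [cls, mem_filter] at *
    exact ⟨hy.1, hκ.refine _ _ _ hy.2⟩
  have hcover : ∀ x ∈ X, ∃ d < L, x ∈ Y d := by
    intro x hx
    by_contra hcon
    push Not at hcon
    have h0 : t < m L x := by
      have := hcon 0 hL
      simpa [Y, hx] using this
    have hd : ∀ d, 1 ≤ d → d < L → t * m (d + 1) x < m d x := by
      intro d h1 h2
      have := hcon d h2
      simpa [Y, hx, Nat.one_le_iff_ne_zero.1 h1] using this
    have key : ∀ j, j < L → t ^ (j + 1) < m (L - j) x := by
      intro j
      induction j with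
      | zero => intro _; simpa using h0
      | succ j ih =>
        intro hj
        have h1 := ih (by omega)
        have h2 := hd (L - (j + 1)) (by omega) (by omega)
        rw [show L - (j + 1) + 1 = L - j by omega] at h2
        refine lt_of_le_of_lt ?_ h2
        rw [pow_succ, mul_comm]
        exact Nat.mul_le_mul_left _ h1.le
    have h1 := key (L - 1) (by omega)
    rw [show L - 1 + 1 = L by omega] at h1
    have h2 : m (L - (L - 1)) x ≤ X.card := card_le_card (filter_subset _ _)
    omega
  have hsub : (univ.filter fun a => ∃ x ∈ X, ∃ y ∈ X, κ L x = κ L y ∧ x a ≠ y a) ⊆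
      (range L).biUnion fun d => (Y d).biUnion fun x => vary (cls X (κ (e d)) x) := by
    intro a ha
    obtain ⟨x, hx, y, hy, hxy, ha⟩ := (mem_filter.1 ha).2
    obtain ⟨d, hd, hxd⟩ := hcover x hx
    refine mem_biUnion.2 ⟨d, mem_range.2 hd, mem_biUnion.2 ⟨x, hxd, ?_⟩⟩
    simp only [vary, mem_filter, mem_univ, true_and]
    refine ⟨x, mem_cls_self hx, y, mem_filter.2 ⟨hy, ?_⟩, ha⟩
    have he : e d ≤ L := by
      simp only [e]; split_ifs <;> omega
    obtain ⟨j, hj⟩ := Nat.exists_eq_add_of_le he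
    rw [hj] at hxy
    exact (hrefine _ _ _ _ hxy).symm
  refine (card_le_card hsub).trans ((card_biUnion_le_card_mul _ _ (2 * t * σ * X.card) ?_).trans
    (by rw [card_range]))
  intro d hd
  rw [mem_range] at hd
  have hYX : Y d ⊆ X := by
    simp only [Y]; split_ifs <;> exact filter_subset _ _
  refine card_biUnion_vary_le hYX (κ (e d)) (2 * t * σ) fun x hx => ?_
  have hxX := hYX hx
  by_cases h0 : d = 0
  · subst h0
    simp only [Y, if_pos, mem_filter] at hx
    simp only [e, if_pos]
    obtain ⟨l, rfl⟩ : ∃ l, L = l + 1 := ⟨L - 1, by omega⟩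
    have h1 : (vary (cls X (κ (l + 1)) x)).card ≤ m (l + 1) x * σ * m (l + 1) x := by
      refine card_vary_le (p := pol l) (hi := n - lo) ?_ ?_
      · intro y hy; exact hhi _ _ (mem_filter.1 hy).1
      · have := hinv l x hxX
        omega
    refine h1.trans (Nat.mul_le_mul_right _ (Nat.mul_le_mul_right _ ?_))
    have := hx.2
    omega
  · simp only [Y, if_neg h0, mem_filter] at hx
    simp only [e, if_neg h0]
    obtain ⟨d, rfl⟩ : ∃ d', d = d' + 1 := ⟨d - 1, by omega⟩
    -- Alternation enters here: the class inherits common coordinates of value `pol d` from its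
    -- parent and has its own of the opposite value. The two defects add up to at most (parent size
    -- + class size)σ, which is linear in the class size because the parent is at most t times
    -- larger.
    have h1 := card_vary_add_le (cls X (κ (d + 1 + 1)) x) ⟨x, mem_cls_self hxX⟩ (pol d)
    have h2 := hinv d x hxX
    have h3 := hinv (d + 1) x hxX
    rw [pol_succ] at h3
    have h4 := card_le_card (common_anti (p := pol d) (hmono (d + 1) x))
    have h5 := hx.2
    have h6 : m (d + 1) x * σ ≤ t * m (d + 1 + 1) x * σ := Nat.mul_le_mul_right _ h5
    have h7 : 1 * m (d + 1 + 1) x * σ ≤ t * m (d + 1 + 1) x * σ := by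
      refine Nat.mul_le_mul_right _ (Nat.mul_le_mul_right _ ?_)
      by_contra h
      have : t = 0 := by omega
      rw [this, zero_mul] at h5
      have := hmpos (d + 1) x hxX
      omega
    have h8 : 2 * t * σ * (cls X (κ (d + 1 + 1)) x).card = 2 * (t * m (d + 1 + 1) x * σ) := by
      simp only [m]; ring
    rw [h8]
    rw [one_mul] at h7
    simp only [m] at *
    omega

end

/-! ### Transcripts -/

/-- The points queried by an algorithm on `f`. -/
def trace {n : ℕ} (f : BoolFun n) : DetAlg n → List (Fin n → Bool)
  | DetAlg.halt _ => []
  | DetAlg.query x next => x :: trace f (next (f x))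

theorem length_trace {n : ℕ} (f : BoolFun n) (T : DetAlg n) :
    (trace f T).length = T.numQueries f := by
  induction T with
  | halt b => rfl
  | query x next ih => simp [trace, DetAlg.numQueries, ih]

/-- The answers to the first t queries determine query t + 1 as well. -/
theorem take_trace_congr {n : ℕ} {f f' : BoolFun n} (T : DetAlg n) (t : ℕ)
    (h : ∀ x ∈ (trace f T).take t, f' x = f x) :
    (trace f' T).take (t + 1) = (trace f T).take (t + 1) := by
  induction T generalizing t with
  | halt b => rfl
  | query x next ih =>
    cases t with
    | zero => simp [trace]
    | succ t =>
      simp only [trace, List.take_succ_cons, List.mem_cons, forall_eq_or_imp] at h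
      rw [trace, trace, List.take_succ_cons, List.take_succ_cons, h.1, ih _ t h.2]

theorem output_congr {n : ℕ} {f f' : BoolFun n} (T : DetAlg n)
    (h : ∀ x ∈ trace f T, f' x = f x) :
    trace f' T = trace f T ∧ T.output f' = T.output f := by
  induction T with
  | halt b => exact ⟨rfl, rfl⟩
  | query x next ih =>
    simp only [trace, List.mem_cons, forall_eq_or_imp] at h
    have := ih (f x) h.2
    simp only [trace, DetAlg.output, h.1]
    exact ⟨by rw [this.1], this.2⟩

open Classical in
/-- The points of a list that lie in the middle layers. -/
noncomputable def mid {n : ℕ} (lo : ℕ) (l : List (Fin n → Bool)) : Finset (Fin n → Bool) :=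
  l.toFinset.filter (Middle lo)

theorem mem_mid {n lo : ℕ} {l : List (Fin n → Bool)} {x : Fin n → Bool} :
    x ∈ mid lo l ↔ x ∈ l ∧ Middle lo x := by
  simp [mid]

section

variable {n M N L : ℕ} [NeZero M]

/-! ### Resampling a term -/

/-- Change the term at the edge `e` to `g` on the coordinates in `A`. -/
def resample (τ : Terms n M N L) (e : Fin L → Option (Fin N)) (A : Finset (Fin n))
    (g : Fin n → Fin M) : Terms n M N L :=
  Function.update τ e fun a => if a ∈ A then g a else τ e a

omit [NeZero M] in
theorem resample_self {τ : Terms n M N L} {e : Fin L → Option (Fin N)} {A : Finset (Fin n)}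
    {g : Fin n → Fin M} (a : Fin n) :
    resample τ e A g e a = if a ∈ A then g a else τ e a := by
  simp [resample]

omit [NeZero M] in
theorem resample_of_ne {τ : Terms n M N L} {e e' : Fin L → Option (Fin N)} {A : Finset (Fin n)}
    {g : Fin n → Fin M} (h : e' ≠ e) : resample τ e A g e' = τ e' := by
  simp [resample, h]

omit [NeZero M] in
theorem resample_resample (τ : Terms n M N L) (e : Fin L → Option (Fin N)) (A : Finset (Fin n))
    (g g' : Fin n → Fin M) : resample (resample τ e A g) e A g' = resample τ e A g' := by
  funext e'
  by_cases h : e' = e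
  · subst h
    funext a
    simp only [resample_self]
    split_ifs <;> rfl
  · rw [resample_of_ne h, resample_of_ne h, resample_of_ne h]

omit [NeZero M] in
-- Exchanging the parts of `τ e` and `g` on A is an involution of the pairs, so resampling preserves
-- the uniform measure.
theorem sum_resample (e : Fin L → Option (Fin N)) (A : Finset (Fin n))
    (F : Terms n M N L → ℝ) :
    ∑ τ, ∑ g, F (resample τ e A g) = Fintype.card (Fin n → Fin M) * ∑ τ, F τ := by
  let Φ : Terms n M N L × (Fin n → Fin M) → Terms n M N L × (Fin n → Fin M) := fun p =>
    (resample p.1 e A p.2, fun a => if a ∈ A then p.1 e a else p.2 a)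
  have hΦ : Function.Involutive Φ := by
    rintro ⟨τ, g⟩
    simp only [Φ, resample_resample, Prod.mk.injEq]
    constructor
    · funext e'
      by_cases h : e' = e
      · subst h
        funext a
        simp only [resample_self]
        split_ifs <;> rfl
      · rw [resample_of_ne h]
    · funext a
      simp only [resample_self]
      split_ifs <;> rfl
  calc ∑ τ, ∑ g, F (resample τ e A g)
      = ∑ p : Terms n M N L × (Fin n → Fin M), F (Φ p).1 := (Fintype.sum_prod_type' _).symm
    _ = ∑ p : Terms n M N L × (Fin n → Fin M), F p.1 :=
        hΦ.bijective.sum_comp fun p : Terms n M N L × (Fin n → Fin M) => F p.1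
    _ = _ := by
        rw [Fintype.sum_prod_type]
        simp [mul_sum]

/-- An inequality between probabilities may be checked conditionally on everything but the resampled
part. -/
theorem card_le_of_resample {e : Fin L → Option (Fin N)} {A : Finset (Fin n)} {c : ℝ}
    {B G : Terms n M N L → Prop} [DecidablePred B] [DecidablePred G]
    (h : ∀ τ, ((univ.filter fun g => B (resample τ e A g)).card : ℝ) ≤
      c * (univ.filter fun g => G (resample τ e A g)).card) :
    ((univ.filter B).card : ℝ) ≤ c * (univ.filter G).card := by
  have h1 := sum_resample e A fun τ => if B τ then (1 : ℝ) else 0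
  have h2 := sum_resample e A fun τ => if G τ then (1 : ℝ) else 0
  simp only [sum_boole] at h1 h2
  have hpos : (0 : ℝ) < Fintype.card (Fin n → Fin M) := by
    exact_mod_cast Fintype.card_pos
  refine le_of_mul_le_mul_left ?_ hpos
  rw [← h1, mul_left_comm, ← h2, mul_sum]
  exact sum_le_sum fun τ _ => h τ

theorem card_avoid (S : Finset (Fin n)) :
    ((univ.filter fun g : Fin n → Fin M => ∀ a ∈ S, g a ≠ 0).card : ℝ) =
      (M : ℝ) ^ n * (1 - 1 / (M : ℝ)) ^ S.card := by
  have hM : (M : ℝ) ≠ 0 := by exact_mod_cast NeZero.ne M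
  have h1 : (univ.filter fun g : Fin n → Fin M => ∀ a ∈ S, g a ≠ 0) =
      Fintype.piFinset fun a => if a ∈ S then {0}ᶜ else univ := by
    ext g
    simp only [mem_filter, mem_univ, true_and, Fintype.mem_piFinset]
    refine forall_congr' fun a => ?_
    by_cases h : a ∈ S <;> simp [h]
  have h2 : ∀ a, (((if a ∈ S then {0}ᶜ else univ : Finset (Fin M)).card : ℕ) : ℝ) =
      M * (if a ∈ S then 1 - 1 / (M : ℝ) else 1) := by
    intro a
    split_ifs
    · rw [card_compl, card_singleton, Fintype.card_fin,
        Nat.cast_sub (Nat.one_le_iff_ne_zero.2 (NeZero.ne M))]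
      field_simp
      simp
    · simp
  rw [h1, Fintype.card_piFinset, Nat.cast_prod, prod_congr rfl fun a _ => h2 a, prod_mul_distrib,
    prod_const, card_univ, Fintype.card_fin, prod_ite_mem]
  simp

/-! ### Relevant edges -/

/-- The edge `e` below a node at depth `d` is relevant for `x`: the point `x` passes through the
node, `e` is among the hits of `x`, and there is at most one earlier hit. -/
def Rel (τ : Terms n M N L) (x : Fin n → Bool) (d : ℕ) (e : Fin L → Option (Fin N)) : Prop :=
  ∃ (u : List (Fin N)) (i : Fin N), u.length = d ∧ enc L (i :: u) = e ∧ Reach τ x u ∧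
    i ∈ hits τ u x ∧ ((hits τ u x).filter (· < i)).card ≤ 1

theorem card_filter_card_lt_le (H : Finset (Fin N)) :
    (H.filter fun i => (H.filter (· < i)).card ≤ 1).card ≤ 2 := by
  rw [← card_range 2]
  refine card_le_card_of_injOn (fun i => (H.filter (· < i)).card) ?_ ?_
  · intro i hi
    have := (mem_filter.1 hi).2
    simp only [coe_range, Set.mem_Iio]
    omega
  · have key : ∀ i ∈ H, ∀ j, i < j → (H.filter (· < i)).card < (H.filter (· < j)).card := by
      intro i hi j hij
      refine card_lt_card ⟨fun k hk => ?_, fun hsub => ?_⟩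
      · rw [mem_filter] at *
        exact ⟨hk.1, hk.2.trans hij⟩
      · have := hsub (mem_filter.2 ⟨hi, hij⟩)
        exact lt_irrefl _ (mem_filter.1 this).2
    intro i hi j hj hij
    have hi := (mem_filter.1 hi).1
    have hj := (mem_filter.1 hj).1
    rcases lt_trichotomy i j with h | h | h
    · exact absurd hij (key i hi j h).ne
    · exact h
    · exact absurd hij (key j hj i h).ne'

-- A point visits at most one node of each depth, and there only its first two hits count. The bound
-- does not depend on N, which may be exponentially large, so a union bound over edges becomes
-- affordable.
open Classical in
theorem card_rel_le (τ : Terms n M N L) (x : Fin n → Bool) (d : ℕ) :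
    (univ.filter fun e => Rel τ x d e).card ≤ 2 := by
  by_cases h : ∃ u, u.length = d ∧ Reach τ x u
  · obtain ⟨u, hu, hr⟩ := h
    refine le_trans (card_le_card (t := ((hits τ u x).filter fun i =>
      ((hits τ u x).filter (· < i)).card ≤ 1).image fun i => enc L (i :: u)) ?_)
      (card_image_le.trans (card_filter_card_lt_le _))
    intro e he
    obtain ⟨u', i, hu', rfl, hr', hi, hc⟩ := (mem_filter.1 he).2
    obtain rfl := reach_unique hr hr' (hu.trans hu'.symm)
    exact mem_image.2 ⟨i, mem_filter.2 ⟨hi, hc⟩, rfl⟩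
  · rw [filter_false_of_mem, card_empty]
    · exact Nat.zero_le _
    · rintro e - ⟨u, i, hu, -, hr, -⟩
      exact h ⟨u, hu, hr⟩

/-- Some hierarchy separates `x` from `z` at depth `d + 1`. -/
def Sep (L s : ℕ) (X : Finset (Fin n → Bool)) (x z : Fin n → Bool) (d : ℕ) : Prop :=
  ∃ κ, Chain L s X κ ∧ κ d x = κ d z ∧ κ (d + 1) x ≠ κ (d + 1) z

theorem Sep.symm {s d : ℕ} {X : Finset (Fin n → Bool)} {x z : Fin n → Bool}
    (h : Sep L s X x z d) : Sep L s X z x d := by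
  obtain ⟨κ, h1, h2, h3⟩ := h
  exact ⟨κ, h1, h2.symm, h3.symm⟩

/-- Two points of `X` share a relevant edge although a hierarchy separates them. -/
def Bad (s : ℕ) (τ : Terms n M N L) (X : Finset (Fin n → Bool)) : Prop :=
  ∃ d < L, ∃ x ∈ X, ∃ z ∈ X, ∃ e, Rel τ x d e ∧ Rel τ z d e ∧ Sep L s X x z d

theorem rel_of_reach_cons {τ : Terms n M N L} {x : Fin n → Bool} {u : List (Fin N)} {i : Fin N}
    (h : Reach τ x (i :: u)) : Rel τ x u.length (enc L (i :: u)) := by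
  refine ⟨u, i, rfl, rfl, h.1, by rw [h.2]; simp, ?_⟩
  rw [h.2]
  exact (card_filter_le _ _).trans (by simp)

/-- Outside the bad event, points passing through the same node are in the same class. -/
theorem label_eq_of_reach {s : ℕ} {τ : Terms n M N L} {X : Finset (Fin n → Bool)} (h : ¬ Bad s τ X)
    {κ : ℕ → (Fin n → Bool) → Fin n → Bool} (hκ : Chain L s X κ) {x z : Fin n → Bool}
    (hx : x ∈ X) (hz : z ∈ X) {u : List (Fin N)} (hu : u.length ≤ L) (hxu : Reach τ x u)
    (hzu : Reach τ z u) : κ u.length x = κ u.length z := by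
  induction u with
  | nil => exact hκ.base x z
  | cons i u ih =>
    by_contra hne
    rw [List.length_cons] at hu
    exact h ⟨u.length, by omega, x, hx, z, hz, enc L (i :: u), rel_of_reach_cons hxu,
      rel_of_reach_cons hzu, κ, hκ, ih (by omega) hxu.1 hzu.1, hne⟩

theorem reach_congr {τ τ' : Terms n M N L} {e : Fin L → Option (Fin N)} {x : Fin n → Bool}
    (hne : ∀ e', e' ≠ e → τ' e' = τ e') {u : List (Fin N)}
    (hu : ∀ i v, (i :: v).length ≤ u.length → enc L (i :: v) ≠ e) (hx : Reach τ x u) :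
    Reach τ' x u := by
  induction u with
  | nil => trivial
  | cons i u ih =>
    refine ⟨ih (fun j v hjv => hu j v (hjv.trans (by simp))) hx.1, ?_⟩
    rw [← hx.2]
    ext j
    rw [mem_hits, mem_hits, hne _ (hu j u (by simp))]

theorem hits_congr {τ τ' : Terms n M N L} {e : Fin L → Option (Fin N)}
    (hne : ∀ e', e' ≠ e → τ' e' = τ e') {u : List (Fin N)} {i : Fin N} (hu : u.length < L)
    (he : enc L (i :: u) = e) {x : Fin n → Bool} {j : Fin N} (hj : j ≠ i) :
    j ∈ hits τ' u x ↔ j ∈ hits τ u x := by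
  rw [mem_hits, mem_hits, hne]
  intro h
  rw [← he] at h
  exact hj (List.cons.inj (enc_injOn (by simp; omega) (by simp; omega) h)).1

/-- Resampling a separated relevant edge on the common coordinates of a cluster leaves the
transcript unchanged, unless the new term is consistent with a point outside the cluster. -/
theorem resample_good {lo s t d : ℕ} {τ : Terms n M N L}
    {v : List (Fin N) → (Fin n → Bool) → Bool} {T : DetAlg n} {x : Fin n → Bool}
    {e : Fin L → Option (Fin N)} {κ : ℕ → (Fin n → Bool) → Fin n → Bool} {X : Finset (Fin n → Bool)}
    (hX : X = mid lo ((trace (fn lo τ v) T).take (t + 1)))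
    (hbad : ¬ Bad s τ (mid lo ((trace (fn lo τ v) T).take t)))
    (hx : x ∈ mid lo ((trace (fn lo τ v) T).take t)) (hd : d < L) (hxe : Rel τ x d e)
    (hκ : Chain L s X κ) {g : Fin n → Fin M}
    (hg : ∀ z ∈ X, κ d x = κ d z → κ (d + 1) x ≠ κ (d + 1) z →
      ∃ a ∈ common (pol d) (cls X (κ (d + 1)) x), g a = 0 ∧ z a ≠ pol d) :
    (trace (fn lo (resample τ e (common (pol d) (cls X (κ (d + 1)) x)) g) v) T).take (t + 1) =
      (trace (fn lo τ v) T).take (t + 1) ∧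
    Rel (resample τ e (common (pol d) (cls X (κ (d + 1)) x)) g) x d e := by
  set A := common (pol d) (cls X (κ (d + 1)) x) with hA
  set τ' := resample τ e A g with hτ'
  set X' := mid lo ((trace (fn lo τ v) T).take t) with hX'
  obtain ⟨u, i, hul, he, hru, hi, hic⟩ := hxe
  have hXX : X' ⊆ X := by
    intro z hz
    rw [hX, mem_mid]
    rw [hX', mem_mid] at hz
    exact ⟨(List.take_subset_take_left _ (Nat.le_succ t)) hz.1, hz.2⟩
  have hne : ∀ e', e' ≠ e → τ' e' = τ e' := fun e' h => resample_of_ne h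
  -- All members of the class equal `pol d` on A, so they cannot see the part of the term in A.
  have hsame : ∀ z ∈ X, κ (d + 1) z = κ (d + 1) x → hits τ' u z = hits τ u z := by
    intro z hz hzx
    ext j
    by_cases hj : j = i
    · subst hj
      rw [mem_hits, mem_hits, he, hul]
      have hzA : ∀ a ∈ A, z a = pol d := fun a ha =>
        (mem_filter.1 ha).2 z (mem_filter.2 ⟨hz, hzx⟩)
      refine forall_congr' fun a => ?_
      by_cases ha : a ∈ A
      · simp [hzA a ha]
      · rw [hτ', resample_self, if_neg ha]
    · exact hits_congr hne (hul.trans_lt hd) he hj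
  have hrel' : Rel τ' x d e := by
    refine ⟨u, i, hul, he, reach_congr hne ?_ hru, ?_, ?_⟩
    · intro j w hjw h
      rw [← he] at h
      have := enc_injOn (hjw.trans (hul.trans_lt hd).le) (by simp; omega) h
      rw [this] at hjw
      simp at hjw
    · rwa [hsame x (hXX hx) rfl]
    · rwa [hsame x (hXX hx) rfl]
  refine ⟨take_trace_congr T t fun z hz => ?_, hrel'⟩
  by_cases hzm : Middle lo z
  swap
  · exact fn_eq_of_not_middle hzm
  have hzX' : z ∈ X' := mem_mid.2 ⟨hz, hzm⟩
  refine fn_congr ?_ fun w _ => rfl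
  refine out_congr (hul.trans_lt hd) (i₀ := i) (by rw [he]; exact hne) (fun hzu => ?_) L []
    (by simp) trivial
  have hdz : κ d x = κ d z := by
    have := label_eq_of_reach hbad (hκ.mono hXX) hx hzX' (hul.trans_lt hd).le hru hzu
    rwa [hul] at this
  by_cases hsep : κ (d + 1) x = κ (d + 1) z
  · exact Or.inl (hsame z (hXX hzX') hsep.symm)
  · obtain ⟨a, ha, hga, hza⟩ := hg z (hXX hzX') hdz hsep
    have hnot : i ∉ hits τ' u z := by
      rw [mem_hits, he, hul]
      intro h
      refine hza (h a ?_)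
      rw [hτ', resample_self, if_pos ha, hga]
    have heq : hits τ' u z = (hits τ u z).erase i := by
      ext j
      by_cases hj : j = i
      · subst hj; simp [hnot]
      · rw [hits_congr hne (hul.trans_lt hd) he hj]; simp [hj]
    -- If z hit the old term, then e was not relevant for z, as `Bad` has not yet occurred. So z has
    -- two earlier hits, and losing the hit i leaves it with several.
    by_cases hiz : i ∈ hits τ u z
    · right
      have h2 : 2 ≤ ((hits τ u z).filter (· < i)).card := by
        by_contra hlt
        exact hbad ⟨d, hd, x, hx, z, hzX', e, ⟨u, i, hul, he, hru, hi, hic⟩,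
          ⟨u, i, hul, he, hzu, hiz, by omega⟩, κ, hκ.mono hXX, hdz, hsep⟩
      have h3 : (hits τ u z).filter (· < i) ⊆ (hits τ u z).erase i := by
        intro j hj
        rw [mem_filter] at hj
        exact mem_erase.2 ⟨hj.2.ne, hj.1⟩
      refine ⟨h2.trans (card_le_card (filter_subset _ _)), ?_⟩
      rw [heq]
      exact h2.trans (card_le_card h3)
    · left
      rw [heq, erase_eq_of_notMem hiz]

end

/-! ### Probability of the bad event -/

section

variable {n M N L : ℕ} [NeZero M]

/-- The bad event occurs first at time `t`, between the points queried at times `j` and `t`, at the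
edge `e` below depth `d`. -/
def BadAt (lo s : ℕ) (v : List (Fin N) → (Fin n → Bool) → Bool) (T : DetAlg n) (t j d : ℕ)
    (e : Fin L → Option (Fin N)) (τ : Terms n M N L) : Prop :=
  ∃ x y, (trace (fn lo τ v) T)[j]? = some x ∧ (trace (fn lo τ v) T)[t]? = some y ∧
    ¬ Bad s τ (mid lo ((trace (fn lo τ v) T).take t)) ∧ Middle lo x ∧ Middle lo y ∧
    Rel τ x d e ∧ Rel τ y d e ∧ Sep L s (mid lo ((trace (fn lo τ v) T).take (t + 1))) x y d

theorem card_mid_le (lo : ℕ) (l : List (Fin n → Bool)) : (mid lo l).card ≤ l.length := by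
  classical
  exact (card_filter_le _ _).trans l.toFinset_card_le

theorem card_filter_eq_sum_fiber {Ω α : Type*} [Fintype Ω] [DecidableEq α] (f : Ω → α)
    (P : Ω → Prop) [DecidablePred P] : ((univ.filter P).card : ℝ) =
      ∑ a ∈ univ.image f, ((univ.filter fun ω => P ω ∧ f ω = a).card : ℝ) := by
  rw [card_eq_sum_card_fiberwise (f := f) (t := univ.image f)
    fun ω _ => mem_image_of_mem f (mem_univ ω)]
  push_cast
  refine sum_congr rfl fun a _ => ?_
  rw [filter_filter]

-- Fix the first t + 1 queries and all of τ except the term at e on the common coordinates A of the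
-- class of x. The point y hits the resampled term only if the term avoids more than s coordinates
-- of A, which has probability at most δ. With probability at least 1/2 the term contains, for each
-- separated point, a coordinate of A that this point misses, and then the queries and the relevance
-- of e for x persist. Hence the factor 2δ.
open Classical in
theorem card_badAt_le {lo s t j d q : ℕ} {v : List (Fin N) → (Fin n → Bool) → Bool} {T : DetAlg n}
    (htq : t + 1 ≤ q) (hjt : j < t) (hd : d < L) (hδ : q * (1 - 1 / (M : ℝ)) ^ s ≤ 1 / 2)
    (e : Fin L → Option (Fin N)) :
    ((univ.filter fun τ : Terms n M N L => BadAt lo s v T t j d e τ).card : ℝ) ≤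
      2 * (1 - 1 / (M : ℝ)) ^ s *
        (univ.filter fun τ : Terms n M N L =>
          ∃ x, (trace (fn lo τ v) T)[j]? = some x ∧ Rel τ x d e).card := by
  set δ : ℝ := (1 - 1 / (M : ℝ)) ^ s with hδdef
  have hM1 : (1 : ℝ) ≤ M := by exact_mod_cast Nat.one_le_iff_ne_zero.2 (NeZero.ne M)
  have hr0 : 0 ≤ 1 - 1 / (M : ℝ) := by
    rw [sub_nonneg, div_le_one (by linarith)]; exact hM1
  have hr1 : 1 - 1 / (M : ℝ) ≤ 1 := by
    have : 0 ≤ 1 / (M : ℝ) := by positivity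
    linarith
  have hδ0 : 0 ≤ δ := pow_nonneg hr0 _
  have hpow : (0 : ℝ) < (M : ℝ) ^ n := by positivity
  rw [card_filter_eq_sum_fiber (fun τ : Terms n M N L => (trace (fn lo τ v) T).take (t + 1)),
    card_filter_eq_sum_fiber (fun τ : Terms n M N L => (trace (fn lo τ v) T).take (t + 1))
      (fun τ => ∃ x, (trace (fn lo τ v) T)[j]? = some x ∧ Rel τ x d e), mul_sum]
  refine sum_le_sum fun η _ => ?_
  by_cases hex : ∃ τ : Terms n M N L, BadAt lo s v T t j d e τ ∧
      (trace (fn lo τ v) T).take (t + 1) = η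
  swap
  · rw [filter_false_of_mem fun τ _ h => hex ⟨τ, h⟩, card_empty, Nat.cast_zero]
    positivity
  -- The hierarchy κ is read off a single τ₁ but is used for every τ with prefix η: the prefix alone
  -- determines X, x and y.
  obtain ⟨τ₁, ⟨x, y, hjx, hty, -, hmx, hmy, -, -, κ, hκ, hxy, hxy'⟩, hη⟩ := hex
  rw [hη] at hκ
  have hjη : η[j]? = some x := by rw [← hη, List.getElem?_take_of_lt (by omega)]; exact hjx
  have htη : η[t]? = some y := by rw [← hη, List.getElem?_take_of_lt (by omega)]; exact hty
  have hxX : x ∈ mid lo η := mem_mid.2 ⟨List.mem_of_getElem? hjη, hmx⟩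
  have hyX : y ∈ mid lo η := mem_mid.2 ⟨List.mem_of_getElem? htη, hmy⟩
  have hXq : (mid lo η).card ≤ q := by
    refine (card_mid_le lo η).trans (le_trans ?_ htq)
    rw [← hη, List.length_take]
    exact min_le_left _ _
  set X := mid lo η with hX
  set A := common (pol d) (cls X (κ (d + 1)) x) with hA
  have hfar : ∀ z ∈ X, κ d x = κ d z → κ (d + 1) x ≠ κ (d + 1) z →
      ((univ.filter fun g : Fin n → Fin M => ∀ a ∈ A.filter (fun a => z a ≠ pol d), g a ≠ 0).card
        : ℝ) ≤ (M : ℝ) ^ n * δ := by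
    intro z hz h1 h2
    rw [card_avoid]
    refine mul_le_mul_of_nonneg_left ?_ hpow.le
    exact pow_le_pow_of_le_one hr0 hr1 (hκ.stable d hd x hxX z hz h1 h2).le
  refine card_le_of_resample (e := e) (A := A) fun τ => ?_
  by_cases h0 : ∃ g₀, BadAt lo s v T t j d e (resample τ e A g₀) ∧
      (trace (fn lo (resample τ e A g₀) v) T).take (t + 1) = η
  swap
  · rw [filter_false_of_mem fun g _ h => h0 ⟨g, h⟩, card_empty, Nat.cast_zero]
    positivity
  obtain ⟨g₀, ⟨x', y', hjx', hty', hnb, -, -, hxe, hye, -⟩, hη₀⟩ := h0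
  have hx' : x' = x := by
    rw [← hη₀, List.getElem?_take_of_lt (by omega), hjx'] at hjη
    exact Option.some.inj hjη
  subst hx'
  have hB : ((univ.filter fun g => BadAt lo s v T t j d e (resample τ e A g) ∧
      (trace (fn lo (resample τ e A g) v) T).take (t + 1) = η).card : ℝ) ≤ (M : ℝ) ^ n * δ := by
    refine le_trans ?_ (hfar y hyX hxy hxy')
    refine Nat.cast_le.2 (card_le_card fun g hg => ?_)
    obtain ⟨⟨x'', y'', -, hty'', -, -, -, -, hye'', -⟩, hη''⟩ := (mem_filter.1 hg).2
    have hy'' : y'' = y := by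
      rw [← hη'', List.getElem?_take_of_lt (by omega), hty''] at htη
      exact Option.some.inj htη
    subst hy''
    obtain ⟨u, i, hul, he, -, hi, -⟩ := hye''
    rw [mem_hits, he, hul] at hi
    refine mem_filter.2 ⟨mem_univ _, fun a ha hga => ?_⟩
    rw [mem_filter] at ha
    refine ha.2 (hi a ?_)
    rw [resample_self, if_pos ha.1, hga]
  have hG : (M : ℝ) ^ n / 2 ≤ ((univ.filter fun g =>
      (∃ x, (trace (fn lo (resample τ e A g) v) T)[j]? = some x ∧ Rel (resample τ e A g) x d e) ∧
      (trace (fn lo (resample τ e A g) v) T).take (t + 1) = η).card : ℝ) := by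
    let Z := X.filter fun z => κ d x' = κ d z ∧ κ (d + 1) x' ≠ κ (d + 1) z
    have hsub : (univ : Finset (Fin n → Fin M)) ⊆ (univ.filter fun g =>
        (∃ x, (trace (fn lo (resample τ e A g) v) T)[j]? = some x ∧
          Rel (resample τ e A g) x d e) ∧
        (trace (fn lo (resample τ e A g) v) T).take (t + 1) = η) ∪
        Z.biUnion fun z => univ.filter fun g : Fin n → Fin M =>
          ∀ a ∈ A.filter (fun a => z a ≠ pol d), g a ≠ 0 := by
      intro g _
      rw [mem_union, or_iff_not_imp_right]
      intro hg
      have hg' : ∀ z ∈ X, κ d x' = κ d z → κ (d + 1) x' ≠ κ (d + 1) z →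
          ∃ a ∈ A, g a = 0 ∧ z a ≠ pol d := by
        intro z hz h1 h2
        by_contra hcon
        push Not at hcon
        refine hg (mem_biUnion.2 ⟨z, mem_filter.2 ⟨hz, h1, h2⟩, mem_filter.2 ⟨mem_univ _, ?_⟩⟩)
        intro a ha hga
        rw [mem_filter] at ha
        exact ha.2 (hcon a ha.1 hga)
      have hxt : x' ∈ mid lo ((trace (fn lo (resample τ e A g₀) v) T).take t) := by
        refine mem_mid.2 ⟨List.mem_of_getElem? (i := j) ?_, hmx⟩
        rw [List.getElem?_take_of_lt hjt]
        exact hjx'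
      have := resample_good (X := X) (by rw [hX, hη₀]) hnb hxt hd hxe hκ hg'
      rw [← hA, resample_resample, hη₀] at this
      refine mem_filter.2 ⟨mem_univ _, ⟨x', ?_, this.2⟩, this.1⟩
      rw [← List.getElem?_take_of_lt (show j < t + 1 by omega), this.1]
      exact hjη
    have h1 := (card_le_card hsub).trans (card_union_le _ _)
    have h2 : ((Z.biUnion fun z => univ.filter fun g : Fin n → Fin M =>
          ∀ a ∈ A.filter (fun a => z a ≠ pol d), g a ≠ 0).card : ℝ) ≤ (M : ℝ) ^ n / 2 := by
      calc _ ≤ ∑ z ∈ Z, ((univ.filter fun g : Fin n → Fin M =>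
              ∀ a ∈ A.filter (fun a => z a ≠ pol d), g a ≠ 0).card : ℝ) := by
            exact_mod_cast card_biUnion_le
        _ ≤ ∑ z ∈ Z, (M : ℝ) ^ n * δ := by
            refine sum_le_sum fun z hz => ?_
            have := mem_filter.1 hz
            exact hfar z this.1 this.2.1 this.2.2
        _ = Z.card * ((M : ℝ) ^ n * δ) := by rw [sum_const, nsmul_eq_mul]
        _ ≤ q * ((M : ℝ) ^ n * δ) := by
            refine mul_le_mul_of_nonneg_right ?_ (by positivity)
            exact_mod_cast (card_filter_le _ _).trans hXq
        _ = (M : ℝ) ^ n * (q * δ) := by ring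
        _ ≤ (M : ℝ) ^ n * (1 / 2) := mul_le_mul_of_nonneg_left hδ hpow.le
        _ = _ := by ring
    have h3 : ((univ : Finset (Fin n → Fin M)).card : ℝ) = (M : ℝ) ^ n := by simp
    have h4 : ((univ : Finset (Fin n → Fin M)).card : ℝ) ≤ _ := Nat.cast_le.2 h1
    rw [h3] at h4
    push_cast at h4
    linarith
  calc _ ≤ (M : ℝ) ^ n * δ := hB
    _ = 2 * δ * ((M : ℝ) ^ n / 2) := by ring
    _ ≤ _ := mul_le_mul_of_nonneg_left hG (by positivity)

/-- In a shortest bad prefix one of the two points is the last query; otherwise the hierarchy,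
restricted to the shorter prefix, would already be bad there. -/
theorem exists_badAt {lo s : ℕ} {v : List (Fin N) → (Fin n → Bool) → Bool} {T : DetAlg n}
    {τ : Terms n M N L} (h : Bad s τ (mid lo (trace (fn lo τ v) T))) :
    ∃ t < (trace (fn lo τ v) T).length, ∃ j < t, ∃ d < L, ∃ e, BadAt lo s v T t j d e τ := by
  classical
  set l := trace (fn lo τ v) T with hl
  have hP : ∃ k, Bad s τ (mid lo (l.take k)) := ⟨l.length, by rwa [List.take_length]⟩
  obtain ⟨t, ht⟩ : ∃ t, Nat.find hP = t + 1 := by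
    refine Nat.exists_eq_succ_of_ne_zero fun h0 => ?_
    have := Nat.find_spec hP
    rw [h0] at this
    obtain ⟨d, -, x, hx, -⟩ := this
    simp [mid] at hx
  have hbad := Nat.find_spec hP
  rw [ht] at hbad
  have hnot : ¬ Bad s τ (mid lo (l.take t)) := Nat.find_min hP (by omega)
  have htl : t < l.length := by
    by_contra hlt
    rw [List.take_of_length_le (by omega)] at hbad hnot
    exact hnot hbad
  have hmem : ∀ x, x ∈ mid lo (l.take (t + 1)) → x ∈ mid lo (l.take t) ∨ x = l[t] := by
    intro x hx
    rw [mem_mid, List.take_succ_eq_append_getElem htl, List.mem_append, List.mem_singleton] at hx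
    rcases hx.1 with h | h
    · exact Or.inl (mem_mid.2 ⟨h, hx.2⟩)
    · exact Or.inr h
  have hsub : mid lo (l.take t) ⊆ mid lo (l.take (t + 1)) := by
    intro x hx
    rw [mem_mid] at *
    exact ⟨(List.take_subset_take_left _ (Nat.le_succ t)) hx.1, hx.2⟩
  obtain ⟨d, hd, x, hx, z, hz, e, hxe, hze, hsep⟩ := hbad
  have key : ∀ x ∈ mid lo (l.take t), Middle lo l[t] → Rel τ x d e → Rel τ l[t] d e →
      Sep L s (mid lo (l.take (t + 1))) x l[t] d →
      ∃ t < l.length, ∃ j < t, ∃ d < L, ∃ e, BadAt lo s v T t j d e τ := by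
    intro x hx hm h1 h2 h3
    rw [mem_mid] at hx
    obtain ⟨j, hj⟩ := List.mem_iff_getElem?.1 hx.1
    have hjt : j < t := by
      by_contra hlt
      rw [List.getElem?_take_eq_none (by omega)] at hj
      simp at hj
    rw [List.getElem?_take_of_lt hjt] at hj
    exact ⟨t, htl, j, hjt, d, hd, e, x, l[t], hj, List.getElem?_eq_getElem htl, hnot, hx.2, hm,
      h1, h2, h3⟩
  rcases hmem x hx with h1 | h1 <;> rcases hmem z hz with h2 | h2
  · exfalso
    obtain ⟨κ, hκ, h3⟩ := hsep
    exact hnot ⟨d, hd, x, h1, z, h2, e, hxe, hze, κ, hκ.mono hsub, h3⟩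
  · subst h2
    exact key x h1 (mem_mid.1 hz).2 hxe hze hsep
  · subst h1
    exact key z h2 (mem_mid.1 hx).2 hze hxe hsep.symm
  · exfalso
    obtain ⟨κ, -, -, h3⟩ := hsep
    rw [h1, h2] at h3
    exact h3 rfl

open Classical in
/-- The bad event is unlikely. -/
theorem card_bad_le {lo s q : ℕ} {v : List (Fin N) → (Fin n → Bool) → Bool} {T : DetAlg n}
    (hT : ∀ f, T.numQueries f ≤ q) (hδ : q * (1 - 1 / (M : ℝ)) ^ s ≤ 1 / 2) :
    ((univ.filter fun τ : Terms n M N L => Bad s τ (mid lo (trace (fn lo τ v) T))).card : ℝ) ≤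
      4 * q ^ 2 * L * (1 - 1 / (M : ℝ)) ^ s * Fintype.card (Terms n M N L) := by
  set δ : ℝ := (1 - 1 / (M : ℝ)) ^ s with hδdef
  have hM1 : (1 : ℝ) ≤ M := by exact_mod_cast Nat.one_le_iff_ne_zero.2 (NeZero.ne M)
  have hδ0 : 0 ≤ δ := pow_nonneg (by rw [sub_nonneg, div_le_one (by linarith)]; exact hM1) _
  have hsub : (univ.filter fun τ : Terms n M N L => Bad s τ (mid lo (trace (fn lo τ v) T))) ⊆
      (range q).biUnion fun t => (range t).biUnion fun j => (range L).biUnion fun d =>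
        univ.biUnion fun e => univ.filter fun τ => BadAt lo s v T t j d e τ := by
    intro τ hτ
    obtain ⟨t, ht, j, hj, d, hd, e, h⟩ := exists_badAt (mem_filter.1 hτ).2
    rw [length_trace] at ht
    simp only [mem_biUnion, mem_range, mem_univ, true_and, mem_filter]
    exact ⟨t, ht.trans_le (hT _), j, hj, d, hd, e, h⟩
  have he : ∀ t ∈ range q, ∀ j ∈ range t, ∀ d ∈ range L,
      ∑ e, ((univ.filter fun τ : Terms n M N L => BadAt lo s v T t j d e τ).card : ℝ) ≤
        4 * δ * Fintype.card (Terms n M N L) := by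
    intro t ht j hj d hd
    rw [mem_range] at *
    calc _ ≤ ∑ e, 2 * δ * ((univ.filter fun τ : Terms n M N L =>
          ∃ x, (trace (fn lo τ v) T)[j]? = some x ∧ Rel τ x d e).card : ℝ) :=
          sum_le_sum fun e _ => card_badAt_le (by omega) hj hd hδ e
      -- After exchanging the sums, each τ contributes its number of relevant edges for query j, at
      -- most two, instead of the number of all edges.
      _ = 2 * δ * ∑ τ : Terms n M N L, ((univ.filter fun e =>
          ∃ x, (trace (fn lo τ v) T)[j]? = some x ∧ Rel τ x d e).card : ℝ) := by
          rw [← mul_sum]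
          congr 1
          simp only [card_filter, Nat.cast_sum]
          exact sum_comm
      _ ≤ 2 * δ * ∑ τ : Terms n M N L, (2 : ℝ) := by
          refine mul_le_mul_of_nonneg_left (sum_le_sum fun τ _ => ?_) (by positivity)
          cases hx : (trace (fn lo τ v) T)[j]? with
          | none => simp
          | some x =>
            simp only [Option.some.injEq, exists_eq_left']
            exact_mod_cast card_rel_le τ x d
      _ = 4 * δ * Fintype.card (Terms n M N L) := by
          rw [sum_const, nsmul_eq_mul, card_univ]; ring
  calc _ ≤ ∑ t ∈ range q, ∑ j ∈ range t, ∑ d ∈ range L, ∑ e,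
        ((univ.filter fun τ : Terms n M N L => BadAt lo s v T t j d e τ).card : ℝ) := by
        refine (Nat.cast_le.2 (card_le_card hsub)).trans ?_
        refine (Nat.cast_le.2 card_biUnion_le).trans ?_
        push_cast
        refine sum_le_sum fun t _ => (Nat.cast_le.2 card_biUnion_le).trans ?_
        push_cast
        refine sum_le_sum fun j _ => (Nat.cast_le.2 card_biUnion_le).trans ?_
        push_cast
        refine sum_le_sum fun d _ => (Nat.cast_le.2 card_biUnion_le).trans ?_
        push_cast
        exact le_rfl
    _ ≤ ∑ t ∈ range q, ∑ j ∈ range q, ∑ d ∈ range L, 4 * δ * Fintype.card (Terms n M N L) := by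
        refine sum_le_sum fun t ht => ?_
        refine le_trans (sum_le_sum fun j hj => sum_le_sum fun d hd => he t ht j hj d hd) ?_
        refine sum_le_sum_of_subset_of_nonneg ?_ ?_
        · intro j hj
          rw [mem_range] at *
          omega
        · intro j _ _
          positivity
    _ = _ := by
        simp only [sum_const, card_range, nsmul_eq_mul]
        ring

end

section

variable {n M N L : ℕ} [NeZero M]

/-! ### Coordinates that vary within a leaf -/

open Classical in
/-- The coordinates on which two points of `X` in the same leaf differ. -/
noncomputable def leafVary (τ : Terms n M N L) (X : Finset (Fin n → Bool)) : Finset (Fin n) :=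
  univ.filter fun a => ∃ x ∈ X, ∃ z ∈ X,
    (∃ w, out τ x L [] = Sum.inr w ∧ out τ z L [] = Sum.inr w) ∧ x a ≠ z a

theorem mem_leafVary {τ : Terms n M N L} {X : Finset (Fin n → Bool)} {a : Fin n} :
    a ∈ leafVary τ X ↔ ∃ x ∈ X, ∃ z ∈ X,
      (∃ w, out τ x L [] = Sum.inr w ∧ out τ z L [] = Sum.inr w) ∧ x a ≠ z a := by
  simp [leafVary]

theorem card_agree_add (x : Fin n → Bool) :
    (agree true x).card + (agree false x).card = n := by
  have := card_filter_add_card_filter_not (s := (univ : Finset (Fin n))) (fun a => x a = true)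
  simpa [agree] using this

theorem Middle.card_agree {lo : ℕ} {x : Fin n → Bool} (h : Middle lo x) (hn : 2 * lo ≤ n)
    (p : Bool) : lo ≤ (agree p x).card ∧ (agree p x).card ≤ n - lo := by
  have := card_agree_add x
  obtain ⟨h1, h2⟩ := h
  cases p
  · omega
  · exact ⟨h1, h2⟩

theorem card_leafVary_le {lo s t q : ℕ} {τ : Terms n M N L} {X : Finset (Fin n → Bool)}
    (hL : 1 ≤ L) (hn : 2 * lo ≤ n) (hX : ∀ x ∈ X, Middle lo x) (hXq : X.card ≤ q)
    (hq : q ≤ t ^ L) (hbad : ¬ Bad s τ X) :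
    (leafVary τ X).card ≤ L * (2 * t * (n - 2 * lo + s) * q) := by
  -- The hierarchy may be chosen after the transcript is known, because `Bad` ranges over all
  -- hierarchies.
  obtain ⟨κ, hκ, hinv⟩ := exists_chain (X := X) (lo := lo) (hi := n - lo) (s := s)
    (σ := n - 2 * lo + s) L (fun p x hx => ((hX x hx).card_agree hn p).1)
    (fun p x hx => ((hX x hx).card_agree hn p).2) (by omega)
  have h1 := card_varied_le hL hn (fun p x hx => ((hX x hx).card_agree hn p).2) (hXq.trans hq)
    hκ hinv
  refine le_trans (card_le_card ?_) (h1.trans (Nat.mul_le_mul_left _ (Nat.mul_le_mul_left _ hXq)))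
  intro a ha
  obtain ⟨x, hx, z, hz, ⟨w, hxw, hzw⟩, hxz⟩ := mem_leafVary.1 ha
  refine mem_filter.2 ⟨mem_univ _, x, hx, z, hz, ?_, hxz⟩
  have h2 := out_eq_inr (show Reach τ x [] from trivial) hxw
  have h3 := out_eq_inr (show Reach τ z [] from trivial) hzw
  have hw : w.length = L := by simpa using h2.2
  have := label_eq_of_reach hbad hκ hx hz hw.le h2.1 h3.1
  rwa [hw] at this

theorem sum_card_leafVary_le {lo s t q : ℕ} {v : List (Fin N) → (Fin n → Bool) → Bool}
    {T : DetAlg n} (hL : 1 ≤ L) (hn : 2 * lo ≤ n) (hq : q ≤ t ^ L)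
    (hT : ∀ f, T.numQueries f ≤ q) (hδ : q * (1 - 1 / (M : ℝ)) ^ s ≤ 1 / 2) :
    (∑ τ : Terms n M N L, (leafVary τ (mid lo (trace (fn lo τ v) T))).card : ℝ) ≤
      ((L * (2 * t * (n - 2 * lo + s) * q) : ℕ) + n * (4 * q ^ 2 * L * (1 - 1 / (M : ℝ)) ^ s)) *
        Fintype.card (Terms n M N L) := by
  classical
  set K : ℕ := L * (2 * t * (n - 2 * lo + s) * q) with hK
  have h1 : ∀ τ : Terms n M N L,
      ((leafVary τ (mid lo (trace (fn lo τ v) T))).card : ℝ) ≤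
        K + n * (if Bad s τ (mid lo (trace (fn lo τ v) T)) then 1 else 0) := by
    intro τ
    by_cases h : Bad s τ (mid lo (trace (fn lo τ v) T))
    · rw [if_pos h, mul_one]
      have h2 : (leafVary τ (mid lo (trace (fn lo τ v) T))).card ≤ n := by
        simpa using card_le_univ (leafVary τ (mid lo (trace (fn lo τ v) T)))
      have h3 : ((leafVary τ (mid lo (trace (fn lo τ v) T))).card : ℝ) ≤ n := by exact_mod_cast h2
      have : (0 : ℝ) ≤ K := Nat.cast_nonneg K
      linarith
    · rw [if_neg h, mul_zero, add_zero]
      refine Nat.cast_le.2 (card_leafVary_le hL hn (fun x hx => (mem_mid.1 hx).2) ?_ hq h)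
      refine (card_mid_le _ _).trans ?_
      rw [length_trace]
      exact hT _
  refine (sum_le_sum fun τ _ => h1 τ).trans ?_
  rw [sum_add_distrib, ← mul_sum, sum_boole, sum_const, nsmul_eq_mul, card_univ, add_mul,
    mul_comm (Fintype.card (Terms n M N L) : ℝ) (K : ℝ), mul_assoc (n : ℝ)]
  have := card_bad_le (L := L) (N := N) (v := v) (lo := lo) hT hδ
  gcongr

/-! ### Coupling of the two kinds of leaves -/

/-- The values of the leaves. -/
abbrev Bits (N L : ℕ) : Type := (Fin L → Option (Fin N)) → Bool

/-- The function with constant leaves. -/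
noncomputable def yesFn (lo : ℕ) (τ : Terms n M N L) (b : Bits N L) : BoolFun n :=
  fn lo τ fun w _ => b (enc L w)

/-- The function whose leaves are parities of the two coordinates `k` and `k'`. -/
noncomputable def noFn (lo : ℕ) (τ : Terms n M N L) (b : Bits N L) (k k' : Fin n) : BoolFun n :=
  fn lo τ fun w x => (b (enc L w) ^^ (x k ^^ x k'))

open Classical in
/-- The parity of `k` and `k'` on the points of `X` in the leaf with code `c`. -/
noncomputable def leafParity (τ : Terms n M N L) (X : Finset (Fin n → Bool)) (k k' : Fin n) :
    Bits N L := fun c =>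
  if h : ∃ x ∈ X, ∃ w, out τ x L [] = Sum.inr w ∧ enc L w = c then h.choose k ^^ h.choose k'
  else false

theorem leafParity_eq {τ : Terms n M N L} {X : Finset (Fin n → Bool)} {k k' : Fin n}
    (hk : k ∉ leafVary τ X) (hk' : k' ∉ leafVary τ X) {x : Fin n → Bool} (hx : x ∈ X)
    {w : List (Fin N)} (hw : out τ x L [] = Sum.inr w) :
    leafParity τ X k k' (enc L w) = (x k ^^ x k') := by
  classical
  have h : ∃ y ∈ X, ∃ w', out τ y L [] = Sum.inr w' ∧ enc L w' = enc L w := ⟨x, hx, w, hw, rfl⟩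
  rw [leafParity, dif_pos h]
  obtain ⟨hy, w', hyw, hww⟩ := h.choose_spec
  have hl := (out_eq_inr (show Reach τ x [] from trivial) hw).2
  have hl' := (out_eq_inr (show Reach τ h.choose [] from trivial) hyw).2
  obtain rfl := enc_injOn (by simp [hl']) (by simp [hl]) hww
  have key : ∀ a, a ∉ leafVary τ X → h.choose a = x a := by
    intro a ha
    by_contra hne
    exact ha (mem_leafVary.2 ⟨_, hy, x, hx, ⟨_, hyw, hw⟩, hne⟩)
  rw [key k hk, key k' hk']

/-- If k and k' vary in no leaf, the parity is constant on the queried points of each leaf and can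
be absorbed into the bit of the leaf. -/
theorem output_noFn {lo : ℕ} {τ : Terms n M N L} {b : Bits N L} {k k' : Fin n} {T : DetAlg n}
    (hk : k ∉ leafVary τ (mid lo (trace (yesFn lo τ b) T)))
    (hk' : k' ∉ leafVary τ (mid lo (trace (yesFn lo τ b) T))) :
    let b' : Bits N L := fun c =>
      (b c ^^ leafParity τ (mid lo (trace (yesFn lo τ b) T)) k k' c)
    trace (noFn lo τ b' k k') T = trace (yesFn lo τ b) T ∧
      T.output (noFn lo τ b' k k') = T.output (yesFn lo τ b) := by
  intro b'
  refine output_congr T fun x hx => ?_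
  by_cases hm : Middle lo x
  · refine fn_congr rfl fun w hw => ?_
    simp only [b']
    rw [leafParity_eq hk hk' (mem_mid.2 ⟨hx, hm⟩) hw, Bool.xor_assoc, Bool.xor_self, Bool.xor_false]
  · exact fn_eq_of_not_middle hm

/-- Unless `k` or `k'` varies within a leaf, the algorithm cannot tell the functions apart. -/
theorem card_yes_le_card_no (lo : ℕ) (τ : Terms n M N L) (k k' : Fin n) (T : DetAlg n) :
    (univ.filter fun b : Bits N L => T.output (yesFn lo τ b) = true).card ≤
      (univ.filter fun b : Bits N L => T.output (noFn lo τ b k k') = true).card +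
      (univ.filter fun b : Bits N L => k ∈ leafVary τ (mid lo (trace (yesFn lo τ b) T)) ∨
        k' ∈ leafVary τ (mid lo (trace (yesFn lo τ b) T))).card := by
  classical
  have h1 : (univ.filter fun b : Bits N L => T.output (yesFn lo τ b) = true) ⊆
      (univ.filter fun b : Bits N L => T.output (yesFn lo τ b) = true ∧
        k ∉ leafVary τ (mid lo (trace (yesFn lo τ b) T)) ∧
        k' ∉ leafVary τ (mid lo (trace (yesFn lo τ b) T))) ∪
      (univ.filter fun b : Bits N L => k ∈ leafVary τ (mid lo (trace (yesFn lo τ b) T)) ∨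
        k' ∈ leafVary τ (mid lo (trace (yesFn lo τ b) T))) := by
    intro b hb
    rw [mem_union, mem_filter, mem_filter]
    rw [mem_filter] at hb
    tauto
  refine (card_le_card h1).trans ((card_union_le _ _).trans (Nat.add_le_add_right ?_ _))
  refine card_le_card_of_injOn (fun b c =>
    (b c ^^ leafParity τ (mid lo (trace (yesFn lo τ b) T)) k k' c)) ?_ ?_
  · intro b hb
    obtain ⟨ho, hk, hk'⟩ := (mem_filter.1 hb).2
    refine mem_filter.2 ⟨mem_univ _, ?_⟩
    rw [(output_noFn hk hk').2, ho]
  -- Injectivity: the image determines the transcript, hence the leaf parities that were added.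
  · intro b hb b' hb' heq
    obtain ⟨-, hk, hk'⟩ := (mem_filter.1 hb).2
    obtain ⟨-, hj, hj'⟩ := (mem_filter.1 hb').2
    have e1 := (output_noFn hk hk').1
    have e2 := (output_noFn hj hj').1
    simp only at e1 e2 heq
    rw [heq] at e1
    rw [e1.symm.trans e2] at heq
    funext c
    have := congrFun heq c
    exact Bool.xor_left_inj.1 this

theorem card_caught_le {lo s t q : ℕ} {T : DetAlg n} (π : Equiv.Perm (Fin n)) (hL : 1 ≤ L)
    (hn : 2 * lo ≤ n) (hq : q ≤ t ^ L) (hT : ∀ f, T.numQueries f ≤ q)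
    (hδ : q * (1 - 1 / (M : ℝ)) ^ s ≤ 1 / 2) :
    (∑ τ : Terms n M N L, ∑ k, (univ.filter fun b : Bits N L =>
        k ∈ leafVary τ (mid lo (trace (yesFn lo τ b) T)) ∨
        π k ∈ leafVary τ (mid lo (trace (yesFn lo τ b) T))).card : ℝ) ≤
      2 * ((L * (2 * t * (n - 2 * lo + s) * q) : ℕ) +
        n * (4 * q ^ 2 * L * (1 - 1 / (M : ℝ)) ^ s)) *
        (Fintype.card (Terms n M N L) * Fintype.card (Bits N L)) := by
  classical
  set K : ℝ := ((L * (2 * t * (n - 2 * lo + s) * q) : ℕ) : ℝ) +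
        n * (4 * q ^ 2 * L * (1 - 1 / (M : ℝ)) ^ s) with hK
  have h1 : ∀ (τ : Terms n M N L) (b : Bits N L) (V : Finset (Fin n)),
      (univ.filter fun k => k ∈ V ∨ π k ∈ V).card ≤ 2 * V.card := by
    intro τ b V
    have h2 : (univ.filter fun k => k ∈ V ∨ π k ∈ V) ⊆ V ∪ V.image π.symm := by
      intro k hk
      rw [mem_union, mem_image]
      rcases (mem_filter.1 hk).2 with h | h
      · exact Or.inl h
      · exact Or.inr ⟨_, h, π.symm_apply_apply k⟩
    have h3 : (V.image π.symm).card ≤ V.card := card_image_le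
    have := (card_le_card h2).trans (card_union_le _ _)
    omega
  calc _ = ∑ b : Bits N L, ∑ τ : Terms n M N L, ((univ.filter fun k =>
          k ∈ leafVary τ (mid lo (trace (yesFn lo τ b) T)) ∨
          π k ∈ leafVary τ (mid lo (trace (yesFn lo τ b) T))).card : ℝ) := by
        simp only [card_filter, Nat.cast_sum]
        rw [sum_congr rfl fun τ _ => sum_comm]
        exact sum_comm
    _ ≤ ∑ b : Bits N L, 2 * ∑ τ : Terms n M N L,
          ((leafVary τ (mid lo (trace (yesFn lo τ b) T))).card : ℝ) := by
        refine sum_le_sum fun b _ => ?_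
        rw [mul_sum]
        refine sum_le_sum fun τ _ => ?_
        exact_mod_cast h1 τ b _
    _ ≤ ∑ b : Bits N L, 2 * (K * Fintype.card (Terms n M N L)) := by
        refine sum_le_sum fun b _ => ?_
        have := sum_card_leafVary_le (N := N) (v := fun w _ => b (enc L w)) hL hn hq hT hδ
        exact mul_le_mul_of_nonneg_left this (by norm_num)
    _ = _ := by
        rw [sum_const, nsmul_eq_mul, card_univ]
        ring

end

section

variable {n M N L : ℕ} [NeZero M]

/-! ### Distance to monotonicity -/

/-- `x` with the coordinates `k` and `k'` replaced by `c` and `c'`. -/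
def corner {n : ℕ} (k k' : Fin n) (x : Fin n → Bool) (c c' : Bool) : Fin n → Bool :=
  Function.update (Function.update x k c) k' c'

/-- The whole interval between `x` and `y` follows the path to the node. -/
def Robust (τ : Terms n M N L) (x y : Fin n → Bool) : List (Fin N) → Prop
  | [] => True
  | i :: u => Robust τ x y u ∧
      Hit (pol u.length) (τ (enc L (i :: u))) (if pol u.length then x else y) ∧
      ∀ j, j ≠ i → ¬ Hit (pol u.length) (τ (enc L (j :: u))) (if pol u.length then y else x)

theorem Hit.of_le {p : Bool} {g : Fin n → Fin M} {x y z : Fin n → Bool} (hxz : x ≤ z)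
    (hzy : z ≤ y) (h : Hit p g (if p then x else y)) : Hit p g z := by
  intro a ha
  have h1 := h a ha
  have h2 := hxz a
  have h3 := hzy a
  cases p
  · rw [if_neg (by simp)] at h1
    rw [h1] at h3
    exact Bool.eq_false_of_le_false h3
  · rw [if_pos rfl] at h1
    rw [h1] at h2
    exact Bool.eq_true_of_true_le h2

theorem Hit.le_of {p : Bool} {g : Fin n → Fin M} {x y z : Fin n → Bool} (hxz : x ≤ z)
    (hzy : z ≤ y) (h : Hit p g z) : Hit p g (if p then y else x) := by
  intro a ha
  have h1 := h a ha
  have h2 := hxz a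
  have h3 := hzy a
  cases p
  · rw [if_neg (by simp)]
    rw [h1] at h2
    exact Bool.eq_false_of_le_false h2
  · rw [if_pos rfl]
    rw [h1] at h3
    exact Bool.eq_true_of_true_le h3

/-- Hits are monotone, so a hit at the least favourable end of the interval and misses at the most
favourable end hold throughout. -/
theorem Robust.reach {τ : Terms n M N L} {x y z : Fin n → Bool} (hxz : x ≤ z) (hzy : z ≤ y)
    {w : List (Fin N)} (h : Robust τ x y w) : Reach τ z w := by
  induction w with
  | nil => trivial
  | cons i u ih =>
    refine ⟨ih h.1, ?_⟩
    ext j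
    rw [mem_hits, mem_singleton]
    constructor
    · intro hj
      by_contra hne
      exact h.2.2 j hne (hj.le_of hxz hzy)
    · rintro rfl
      exact h.2.1.of_le hxz hzy

theorem out_of_reach {τ : Terms n M N L} {x : Fin n → Bool} {w : List (Fin N)} (h : Reach τ x w)
    (d : ℕ) : out τ x (d + w.length) [] = out τ x d w := by
  induction w generalizing d with
  | nil => rfl
  | cons i u ih =>
    rw [List.length_cons, show d + (u.length + 1) = d + 1 + u.length by omega, ih h.1,
      out_succ_of_singleton h.2]

open Classical in
/-- The base points of squares in the directions `k` and `k'` that lie in a single leaf. -/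
noncomputable def goodBase (lo : ℕ) (τ : Terms n M N L) (k k' : Fin n) :
    Finset (Fin n → Bool) :=
  univ.filter fun x => corner k k' x false false = x ∧ Middle lo x ∧
    Middle lo (corner k k' x true true) ∧
    ∃ w : List (Fin N), w.length = L ∧ Robust τ x (corner k k' x true true) w

theorem corner_le_corner (k k' : Fin n) (x : Fin n → Bool) {c₁ c₁' c₂ c₂' : Bool}
    (h : c₁ ≤ c₂) (h' : c₁' ≤ c₂') : corner k k' x c₁ c₁' ≤ corner k k' x c₂ c₂' := by
  intro a
  simp only [corner, Function.update_apply]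
  split_ifs
  · exact h'
  · exact h
  · exact le_rfl

/-- On a good square whose leaf has bit β, the values at (k, k') = (0, !β) and (1, !β) are true and
false, so a monotone g errs at one of them. Distinct base points give disjoint squares. The argument
works for every β, as the coupling with uniform bits requires. -/
theorem farFromMonotone_noFn {lo : ℕ} {τ : Terms n M N L} {k k' : Fin n} (hk : k ≠ k') {ε : ℝ}
    (h : ε * 2 ^ n ≤ (goodBase lo τ k k').card) (b : Bits N L) :
    FarFromMonotone ε (noFn lo τ b k k') := by
  classical
  intro g hg
  refine h.trans (Nat.cast_le.2 ?_)
  have hsub : goodBase lo τ k k' ⊆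
      (univ.filter fun y => noFn lo τ b k k' y ≠ g y).image fun y => corner k k' y false false := by
    intro x hx
    obtain ⟨hx0, hm0, hm1, w, hw, hr⟩ := (mem_filter.1 hx).2
    have hval : ∀ c c', noFn lo τ b k k' (corner k k' x c c') = (b (enc L w) ^^ (c ^^ c')) := by
      intro c c'
      have h1 : x ≤ corner k k' x c c' := by
        conv_lhs => rw [← hx0]
        exact corner_le_corner k k' x (Bool.false_le _) (Bool.false_le _)
      have h2 : corner k k' x c c' ≤ corner k k' x true true :=
        corner_le_corner k k' x (Bool.le_true _) (Bool.le_true _)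
      have hm : Middle lo (corner k k' x c c') :=
        ⟨hm0.1.trans (card_le_card (agree_true_subset h1)),
          (card_le_card (agree_true_subset h2)).trans hm1.2⟩
      have ho := out_of_reach (hr.reach h1 h2) 0
      rw [zero_add, hw] at ho
      rw [noFn, fn_of_middle hm, ho]
      simp [out, corner, hk]
    have hsq : ∀ c c', corner k k' (corner k k' x c c') false false = x := by
      intro c c'
      conv_rhs => rw [← hx0]
      funext a
      simp only [corner, Function.update_apply]
      split_ifs <;> rfl
    have hle := hg (corner_le_corner k k' x (Bool.false_le true) (le_refl (!b (enc L w))))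
    have e1 := hval false (!b (enc L w))
    have e2 := hval true (!b (enc L w))
    rw [mem_image]
    by_cases h1 : g (corner k k' x false (!b (enc L w))) = true
    · refine ⟨_, mem_filter.2 ⟨mem_univ _, ?_⟩, hsq true (!b (enc L w))⟩
      rw [h1] at hle
      rw [Bool.eq_true_of_true_le hle, e2]
      cases b (enc L w) <;> simp
    · refine ⟨_, mem_filter.2 ⟨mem_univ _, ?_⟩, hsq false (!b (enc L w))⟩
      rw [Bool.not_eq_true] at h1
      rw [h1, e1]
      cases b (enc L w) <;> simp
  exact (card_le_card hsub).trans card_image_le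

/-! ### Expected number of good squares -/

-- The exchange involution of `sum_resample`, now for all terms below one node at once.
omit [NeZero M] in
theorem sum_extend {ι : Fin N → Fin L → Option (Fin N)} (hι : Function.Injective ι)
    (F : Terms n M N L → ℝ) :
    ∑ τ : Terms n M N L, ∑ γ : Fin N → Fin n → Fin M, F (Function.extend ι γ τ) =
      Fintype.card (Fin N → Fin n → Fin M) * ∑ τ, F τ := by
  let Φ : Terms n M N L × (Fin N → Fin n → Fin M) → Terms n M N L × (Fin N → Fin n → Fin M) :=
    fun p => (Function.extend ι p.2 p.1, fun j => p.1 (ι j))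
  have hΦ : Function.Involutive Φ := by
    rintro ⟨τ, γ⟩
    simp only [Φ, Prod.mk.injEq]
    constructor
    · funext e
      by_cases h : ∃ j, ι j = e
      · obtain ⟨j, rfl⟩ := h
        rw [hι.extend_apply]
      · rw [Function.extend_apply' _ _ _ h, Function.extend_apply' _ _ _ h]
    · funext j
      rw [hι.extend_apply]
  calc _ = ∑ p : Terms n M N L × (Fin N → Fin n → Fin M), F (Φ p).1 :=
        (Fintype.sum_prod_type' (f := fun (τ : Terms n M N L) (γ : Fin N → Fin n → Fin M) =>
          F (Function.extend ι γ τ))).symm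
    _ = ∑ p : Terms n M N L × (Fin N → Fin n → Fin M), F p.1 :=
        hΦ.bijective.sum_comp fun p : Terms n M N L × (Fin N → Fin n → Fin M) => F p.1
    _ = _ := by
        rw [Fintype.sum_prod_type]
        simp [mul_sum]

theorem robust_congr {τ τ' : Terms n M N L} {x y : Fin n → Bool} {u : List (Fin N)}
    (h : ∀ v : List (Fin N), v.length ≤ u.length → τ' (enc L v) = τ (enc L v)) :
    Robust τ' x y u ↔ Robust τ x y u := by
  induction u with
  | nil => exact Iff.rfl
  | cons i u ih =>
    rw [Robust, Robust, ih fun v hv => h v (hv.trans (by simp)), h (i :: u) le_rfl]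
    refine and_congr_right fun _ => and_congr_right fun _ => ?_
    refine forall_congr' fun j => ?_
    rw [h (j :: u) (by simp)]

open Classical in
theorem card_hit (p : Bool) (x : Fin n → Bool) :
    ((univ.filter fun g : Fin n → Fin M => Hit p g x).card : ℝ) =
      (M : ℝ) ^ n * (1 - 1 / (M : ℝ)) ^ (n - (agree p x).card) := by
  have h := card_avoid (M := M) (agree p x)ᶜ
  rw [card_compl, Fintype.card_fin] at h
  rw [← h]
  congr 2
  ext g
  rw [mem_filter, mem_filter]
  refine and_congr_right fun _ => ⟨fun h a h1 h2 => ?_, fun h a h1 => ?_⟩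
  · simp [agree, h a h2] at h1
  · by_contra h2
    exact h a (by simp [agree, h2]) h1

-- The N terms are independent. The end that must hit term i agrees with p on at least lo
-- coordinates, and the end that must miss the others on at most n - lo. The exponent N - 1 is
-- relaxed to N.
open Classical in
theorem card_level_ge {lo : ℕ} (p : Bool) {x y : Fin n → Bool} (hn : 2 * lo ≤ n)
    (hx : Middle lo x) (hy : Middle lo y) (i : Fin N) :
    (1 - 1 / (M : ℝ)) ^ (n - lo) * (1 - (1 - 1 / (M : ℝ)) ^ lo) ^ N *
      Fintype.card (Fin N → Fin n → Fin M) ≤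
    ((univ.filter fun γ : Fin N → Fin n → Fin M => Hit p (γ i) (if p then x else y) ∧
      ∀ j, j ≠ i → ¬ Hit p (γ j) (if p then y else x)).card : ℝ) := by
  set r : ℝ := 1 - 1 / (M : ℝ) with hr
  have hM1 : (1 : ℝ) ≤ M := by exact_mod_cast Nat.one_le_iff_ne_zero.2 (NeZero.ne M)
  have hr0 : 0 ≤ r := by
    rw [hr, sub_nonneg, div_le_one (by linarith)]; exact hM1
  have hr1 : r ≤ 1 := by
    have : 0 ≤ 1 / (M : ℝ) := by positivity
    rw [hr]
    linarith
  have hpow : (0 : ℝ) ≤ (M : ℝ) ^ n := by positivity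
  have hs0 : 0 ≤ 1 - r ^ lo := sub_nonneg.2 (pow_le_one₀ hr0 hr1)
  have hs1 : 1 - r ^ lo ≤ 1 := by
    have := pow_nonneg hr0 lo
    linarith
  have heq : (univ.filter fun γ : Fin N → Fin n → Fin M => Hit p (γ i) (if p then x else y) ∧
      ∀ j, j ≠ i → ¬ Hit p (γ j) (if p then y else x)) =
      Fintype.piFinset fun j => if j = i then
        (univ.filter fun g : Fin n → Fin M => Hit p g (if p then x else y)) else
        (univ.filter fun g : Fin n → Fin M => Hit p g (if p then y else x))ᶜ := by
    ext γ
    simp only [mem_filter, mem_univ, true_and, Fintype.mem_piFinset]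
    constructor
    · rintro ⟨h1, h2⟩ j
      by_cases hj : j = i
      · subst hj; simpa using h1
      · simpa [hj] using h2 j hj
    · intro h
      refine ⟨by simpa using h i, fun j hj => ?_⟩
      simpa [hj] using h j
  have hA : (M : ℝ) ^ n * r ^ (n - lo) ≤
      ((univ.filter fun g : Fin n → Fin M => Hit p g (if p then x else y)).card : ℝ) := by
    rw [card_hit]
    refine mul_le_mul_of_nonneg_left (pow_le_pow_of_le_one hr0 hr1 ?_) hpow
    have h1 := (hx.card_agree hn p).1
    have h2 := (hy.card_agree hn p).1
    split_ifs <;> omega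
  have hB : (M : ℝ) ^ n * (1 - r ^ lo) ≤
      (((univ.filter fun g : Fin n → Fin M => Hit p g (if p then y else x))ᶜ).card : ℝ) := by
    rw [card_compl, Nat.cast_sub (card_le_univ _), card_hit, mul_sub, mul_one]
    have h3 : (Fintype.card (Fin n → Fin M) : ℝ) = (M : ℝ) ^ n := by simp
    rw [h3]
    refine sub_le_sub_left (mul_le_mul_of_nonneg_left (pow_le_pow_of_le_one hr0 hr1 ?_) hpow) _
    have h1 := (hx.card_agree hn p).2
    have h2 := (hy.card_agree hn p).2
    split_ifs <;> omega
  rw [heq, Fintype.card_piFinset, Nat.cast_prod]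
  have hcard : (Fintype.card (Fin N → Fin n → Fin M) : ℝ) = ∏ _j : Fin N, (M : ℝ) ^ n := by
    simp
  calc _ ≤ ∏ j : Fin N, (M : ℝ) ^ n * (if j = i then r ^ (n - lo) else 1 - r ^ lo) := by
        rw [prod_mul_distrib, ← hcard, mul_comm]
        refine mul_le_mul_of_nonneg_left ?_ (Nat.cast_nonneg _)
        rw [prod_ite, prod_const, prod_const, filter_eq' univ i, if_pos (mem_univ i),
          card_singleton, pow_one]
        refine mul_le_mul_of_nonneg_left ?_ (pow_nonneg hr0 _)
        refine pow_le_pow_of_le_one hs0 hs1 ?_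
        exact (card_le_univ _).trans (by simp)
    _ ≤ _ := by
        refine prod_le_prod (fun j _ => ?_) fun j _ => ?_
        · split_ifs
          · exact mul_nonneg hpow (pow_nonneg hr0 _)
          · exact mul_nonneg hpow hs0
        · by_cases hj : j = i
          · rw [if_pos hj, if_pos hj]
            exact hA
          · rw [if_neg hj, if_neg hj]
            exact hB

/-- The lists of length `d`. -/
def lists (N : ℕ) : ℕ → Finset (List (Fin N))
  | 0 => {[]}
  | d + 1 => ((univ : Finset (Fin N)) ×ˢ lists N d).image fun p => p.1 :: p.2

theorem mem_lists {d : ℕ} {w : List (Fin N)} : w ∈ lists N d ↔ w.length = d := by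
  induction d generalizing w with
  | zero => simp [lists]
  | succ d ih =>
    cases w with
    | nil => simp [lists]
    | cons i u => simp [lists, ih]

-- Robustness along w does not involve the terms below w, so each of the N children of w contributes
-- an independent factor ρ.
open Classical in
theorem sum_card_robust_ge {lo : ℕ} {x y : Fin n → Bool} (hn : 2 * lo ≤ n)
    (hx : Middle lo x) (hy : Middle lo y) {d : ℕ} (hd : d ≤ L) :
    (N * ((1 - 1 / (M : ℝ)) ^ (n - lo) * (1 - (1 - 1 / (M : ℝ)) ^ lo) ^ N)) ^ d *
      Fintype.card (Terms n M N L) ≤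
    ∑ w ∈ lists N d, ((univ.filter fun τ : Terms n M N L => Robust τ x y w).card : ℝ) := by
  set ρ : ℝ := (1 - 1 / (M : ℝ)) ^ (n - lo) * (1 - (1 - 1 / (M : ℝ)) ^ lo) ^ N with hρ
  have hM1 : (1 : ℝ) ≤ M := by exact_mod_cast Nat.one_le_iff_ne_zero.2 (NeZero.ne M)
  have hr0 : 0 ≤ 1 - 1 / (M : ℝ) := by
    rw [sub_nonneg, div_le_one (by linarith)]; exact hM1
  have hr1 : 1 - 1 / (M : ℝ) ≤ 1 := by
    have : 0 ≤ 1 / (M : ℝ) := by positivity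
    linarith
  have hρ0 : 0 ≤ ρ :=
    mul_nonneg (pow_nonneg hr0 _) (pow_nonneg (sub_nonneg.2 (pow_le_one₀ hr0 hr1)) _)
  induction d with
  | zero =>
    have h : (univ.filter fun τ : Terms n M N L => Robust τ x y []) = univ :=
      filter_true_of_mem fun τ _ => (trivial : Robust τ x y [])
    rw [lists, sum_singleton, h, card_univ, pow_zero, one_mul]
  | succ d ih =>
    have hstep : ∀ w ∈ lists N d, ∀ i : Fin N,
        ρ * ((univ.filter fun τ : Terms n M N L => Robust τ x y w).card : ℝ) ≤
          ((univ.filter fun τ : Terms n M N L => Robust τ x y (i :: w)).card : ℝ) := by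
      intro w hw i
      rw [mem_lists] at hw
      have hι : Function.Injective fun j : Fin N => enc L (j :: w) := by
        intro j j' h
        exact (List.cons.inj (enc_injOn (by simp; omega) (by simp; omega) h)).1
      have hpos : (0 : ℝ) < Fintype.card (Fin N → Fin n → Fin M) := by
        exact_mod_cast Fintype.card_pos
      refine le_of_mul_le_mul_left ?_ hpos
      have h1 := sum_extend hι fun τ : Terms n M N L => if Robust τ x y (i :: w) then (1 : ℝ) else 0
      have h2 : ∀ τ : Terms n M N L,
          ∑ γ : Fin N → Fin n → Fin M,
            (if Robust (Function.extend (fun j : Fin N => enc L (j :: w)) γ τ) x y (i :: w)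
              then (1 : ℝ) else 0) =
          if Robust τ x y w then ((univ.filter fun γ : Fin N → Fin n → Fin M =>
            Hit (pol d) (γ i) (if pol d then x else y) ∧
              ∀ j, j ≠ i → ¬ Hit (pol d) (γ j) (if pol d then y else x)).card : ℝ) else 0 := by
        intro τ
        have h3 : ∀ γ : Fin N → Fin n → Fin M,
            Robust (Function.extend (fun j : Fin N => enc L (j :: w)) γ τ) x y (i :: w) ↔
            Robust τ x y w ∧ (Hit (pol d) (γ i) (if pol d then x else y) ∧
              ∀ j, j ≠ i → ¬ Hit (pol d) (γ j) (if pol d then y else x)) := by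
          intro γ
          have h4 : ∀ j, Function.extend (fun j : Fin N => enc L (j :: w)) γ τ (enc L (j :: w)) =
              γ j := fun j => hι.extend_apply γ τ j
          rw [Robust, hw]
          simp only [h4]
          refine and_congr_left fun _ => robust_congr fun v hv => ?_
          refine Function.extend_apply' _ _ _ ?_
          rintro ⟨j, hj⟩
          have := enc_injOn (by simp; omega) (by omega) hj
          rw [← this] at hv
          simp at hv
        by_cases hR : Robust τ x y w
        · simp [h3, hR]
        · simp [h3, hR]
      simp only [h2, sum_boole] at h1
      rw [← h1, ← sum_filter, sum_const, nsmul_eq_mul, mul_left_comm,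
        mul_comm ((univ.filter fun τ : Terms n M N L => Robust τ x y w).card : ℝ), ← mul_assoc]
      exact mul_le_mul_of_nonneg_right (card_level_ge (pol d) hn hx hy i) (Nat.cast_nonneg _)
    rw [lists, sum_image (by rintro ⟨i, u⟩ - ⟨j, v⟩ - h; simpa using h), sum_product_right]
    calc _ = N * ρ * ((N * ρ) ^ d * Fintype.card (Terms n M N L)) := by ring
      _ ≤ N * ρ * ∑ w ∈ lists N d,
          ((univ.filter fun τ : Terms n M N L => Robust τ x y w).card : ℝ) :=
          mul_le_mul_of_nonneg_left (ih (by omega)) (by positivity)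
      _ = ∑ w ∈ lists N d, ∑ _i : Fin N,
          ρ * ((univ.filter fun τ : Terms n M N L => Robust τ x y w).card : ℝ) := by
          simp only [sum_const, card_univ, Fintype.card_fin, nsmul_eq_mul, mul_sum]
          exact sum_congr rfl fun w _ => by ring
      _ ≤ _ := sum_le_sum fun w hw => sum_le_sum fun i _ => hstep w hw i

-- For a fixed square, robust paths to distinct leaves exclude each other, so their probabilities
-- add up.
open Classical in
theorem sum_card_goodBase_ge {lo : ℕ} (hn : 2 * lo ≤ n) (k k' : Fin n) :
    (N * ((1 - 1 / (M : ℝ)) ^ (n - lo) * (1 - (1 - 1 / (M : ℝ)) ^ lo) ^ N)) ^ L *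
      Fintype.card (Terms n M N L) *
      (univ.filter fun x => corner k k' x false false = x ∧ Middle lo x ∧
        Middle lo (corner k k' x true true)).card ≤
    ∑ τ : Terms n M N L, ((goodBase lo τ k k').card : ℝ) := by
  set X := univ.filter fun x => corner k k' x false false = x ∧ Middle lo x ∧
        Middle lo (corner k k' x true true) with hX
  have h1 : ∀ x ∈ X,
      (N * ((1 - 1 / (M : ℝ)) ^ (n - lo) * (1 - (1 - 1 / (M : ℝ)) ^ lo) ^ N)) ^ L *
        Fintype.card (Terms n M N L) ≤
      ((univ.filter fun τ : Terms n M N L => ∃ w : List (Fin N), w.length = L ∧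
        Robust τ x (corner k k' x true true) w).card : ℝ) := by
    intro x hx
    obtain ⟨hx0, hm0, hm1⟩ := (mem_filter.1 hx).2
    refine (sum_card_robust_ge hn hm0 hm1 le_rfl).trans ?_
    have hle : x ≤ corner k k' x true true := by
      conv_lhs => rw [← hx0]
      exact corner_le_corner k k' x (Bool.false_le _) (Bool.false_le _)
    have hdisj : (↑(lists N L) : Set (List (Fin N))).PairwiseDisjoint fun w =>
        univ.filter fun τ : Terms n M N L => Robust τ x (corner k k' x true true) w := by
      intro w hw w' hw' hne
      rw [Function.onFun, disjoint_left]
      intro τ h h'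
      have h := (mem_filter.1 h).2
      have h' := (mem_filter.1 h').2
      refine hne (reach_unique (h.reach le_rfl hle) (h'.reach le_rfl hle) ?_)
      rw [mem_lists.1 hw, mem_lists.1 hw']
    rw [← Nat.cast_sum, ← card_biUnion hdisj]
    refine Nat.cast_le.2 (card_le_card fun τ hτ => ?_)
    obtain ⟨w, hw, h⟩ := mem_biUnion.1 hτ
    exact mem_filter.2 ⟨mem_univ _, w, mem_lists.1 hw, (mem_filter.1 h).2⟩
  calc _ = ∑ x ∈ X, (N * ((1 - 1 / (M : ℝ)) ^ (n - lo) *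
        (1 - (1 - 1 / (M : ℝ)) ^ lo) ^ N)) ^ L * Fintype.card (Terms n M N L) := by
        rw [sum_const, nsmul_eq_mul]; ring
    _ ≤ ∑ x ∈ X, ((univ.filter fun τ : Terms n M N L => ∃ w : List (Fin N), w.length = L ∧
        Robust τ x (corner k k' x true true) w).card : ℝ) := sum_le_sum h1
    _ = ∑ τ : Terms n M N L, ((X.filter fun x => ∃ w : List (Fin N), w.length = L ∧
        Robust τ x (corner k k' x true true) w).card : ℝ) := by
        simp only [card_filter, Nat.cast_sum]
        exact sum_comm
    _ = _ := by
        refine sum_congr rfl fun τ _ => ?_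
        congr 2
        ext x
        simp only [hX, goodBase, mem_filter, mem_univ, true_and, and_assoc]

end

/-! ### The middle layers -/

theorem two_mul_card_agree_sub {n : ℕ} (x : Fin n → Bool) :
    2 * ((agree true x).card : ℝ) - n = ∑ a, if x a then (1 : ℝ) else -1 := by
  have h : ∀ a, (if x a then (1 : ℝ) else -1) = 2 * (if x a = true then 1 else 0) - 1 := by
    intro a
    split_ifs <;> norm_num
  rw [sum_congr rfl fun a _ => h a, sum_sub_distrib, ← mul_sum, sum_boole]
  simp [agree]

/-- Second moment of a sum of independent signs; flipping one coordinate kills the mixed terms. -/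
theorem sum_sq_weight (n : ℕ) :
    ∑ x : Fin n → Bool, ((2 * (agree true x).card - n) ^ 2 : ℝ) = (n * 2 ^ n : ℝ) := by
  have h1 : ∀ a b : Fin n, ∑ x : Fin n → Bool,
      ((if x a then 1 else -1) * (if x b then 1 else -1) : ℝ) =
        if a = b then (2 : ℝ) ^ n else 0 := by
    intro a b
    split_ifs with hab
    · subst hab
      have h2 : ∀ x : Fin n → Bool, (if x a then (1 : ℝ) else -1) *
          (if x a then (1 : ℝ) else -1) = 1 := by
        intro x
        split_ifs <;> norm_num
      simp [h2]
    · have hinv : Function.Involutive fun x : Fin n → Bool => Function.update x a (!x a) := by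
        intro x
        simp
      have h2 := hinv.bijective.sum_comp fun x : Fin n → Bool =>
        (if x a then (1 : ℝ) else -1) * (if x b then (1 : ℝ) else -1)
      have h3 : ∀ x : Fin n → Bool, (if Function.update x a (!x a) a then (1 : ℝ) else -1) *
          (if Function.update x a (!x a) b then (1 : ℝ) else -1) =
          -((if x a then (1 : ℝ) else -1) * (if x b then (1 : ℝ) else -1)) := by
        intro x
        rw [Function.update_self, Function.update_of_ne (Ne.symm hab)]
        cases x a <;> cases x b <;> simp
      simp only [h3, sum_neg_distrib] at h2
      linarith
  simp only [two_mul_card_agree_sub, pow_two, sum_mul_sum]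
  rw [sum_comm]
  rw [sum_congr rfl fun a _ => sum_comm]
  simp only [h1]
  simp

/-- By Chebyshev at least half of the cube satisfies |2|x| - n| ≤ √(2n). Projection to the base of
the square is at most four-to-one and moves the weight by at most 2, which the margin 4 absorbs. -/
theorem card_squares_ge {n lo : ℕ} (h4 : 2 * lo + 4 ≤ n) (hlo : 2 * n ≤ (n - 2 * lo - 4) ^ 2)
    (k k' : Fin n) (P : (Fin n → Bool) → Prop) [DecidablePred P]
    (hP : ∀ x, P x ↔ corner k k' x false false = x ∧ Middle lo x ∧
      Middle lo (corner k k' x true true)) :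
    (2 : ℝ) ^ n ≤ 8 * (univ.filter P).card := by
  classical
  rcases Nat.eq_zero_or_pos n with h0 | hnpos
  · omega
  have hnR : (0 : ℝ) < n := by exact_mod_cast hnpos
  set Y : Finset (Fin n → Bool) :=
    univ.filter fun x => (2 * ((agree true x).card : ℝ) - n) ^ 2 ≤ 2 * n with hY
  have hY2 : (2 : ℝ) ^ n ≤ 2 * Y.card := by
    have h1 : ∑ x ∈ Yᶜ, (2 * n : ℝ) ≤ n * 2 ^ n := by
      rw [← sum_sq_weight n]
      refine (sum_le_sum fun x hx => ?_).trans
        (sum_le_sum_of_subset_of_nonneg (subset_univ Yᶜ) fun x _ _ => sq_nonneg _)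
      rw [mem_compl, hY, mem_filter, not_and, not_le] at hx
      exact (hx (mem_univ _)).le
    rw [sum_const, nsmul_eq_mul, card_compl, Nat.cast_sub (card_le_univ _)] at h1
    have h2 : (Fintype.card (Fin n → Bool) : ℝ) = 2 ^ n := by simp
    rw [h2] at h1
    have h3 : ((2 : ℝ) ^ n - Y.card) * 2 ≤ 2 ^ n := by
      refine le_of_mul_le_mul_left ?_ hnR
      linarith
    linarith
  have hmaps : Y.image (fun x => corner k k' x false false) ⊆ univ.filter P := by
    intro y hy
    obtain ⟨x, hx, rfl⟩ := mem_image.1 hy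
    have hx2 := (mem_filter.1 hx).2
    have hsq : ∀ c c', corner k k' (corner k k' x false false) c c' = corner k k' x c c' := by
      intro c c'
      funext a
      simp only [corner, Function.update_apply]
      split_ifs <;> rfl
    have hbound : lo + 2 ≤ (agree true x).card ∧ (agree true x).card + 2 ≤ n - lo := by
      have h5 : (2 * ((agree true x).card : ℤ) - n) ^ 2 ≤ ((n - 2 * lo - 4 : ℕ) : ℤ) ^ 2 := by
        have h6 : (2 * ((agree true x).card : ℤ) - n) ^ 2 ≤ 2 * n := by exact_mod_cast hx2
        exact h6.trans (by exact_mod_cast hlo)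
      have h7 := abs_le_of_sq_le_sq' h5 (by positivity)
      omega
    have hlow : agree true x ⊆ agree true (corner k k' x false false) ∪ {k, k'} := by
      intro a ha
      simp only [mem_union, mem_insert, mem_singleton, agree, mem_filter, mem_univ, true_and,
        corner, Function.update_apply] at *
      split_ifs <;> tauto
    have hhigh : agree true (corner k k' x true true) ⊆ agree true x ∪ {k, k'} := by
      intro a ha
      simp only [mem_union, mem_insert, mem_singleton, agree, mem_filter, mem_univ, true_and,
        corner, Function.update_apply] at *
      split_ifs at ha <;> tauto
    have hxlow : corner k k' x false false ≤ x := by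
      intro a
      simp only [corner, Function.update_apply]
      split_ifs
      · exact Bool.false_le _
      · exact Bool.false_le _
      · exact le_rfl
    have hxhigh : x ≤ corner k k' x true true := by
      intro a
      simp only [corner, Function.update_apply]
      split_ifs
      · exact Bool.le_true _
      · exact Bool.le_true _
      · exact le_rfl
    have c1 := (card_le_card hlow).trans (card_union_le _ _)
    have c2 := (card_le_card hhigh).trans (card_union_le _ _)
    have c3 : ({k, k'} : Finset (Fin n)).card ≤ 2 := card_le_two
    have c4 := card_le_card (agree_true_subset hxlow)
    have c5 := card_le_card (agree_true_subset hxhigh)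
    refine mem_filter.2 ⟨mem_univ _, (hP _).2 ⟨hsq _ _, ⟨?_, ?_⟩, ?_⟩⟩
    · omega
    · omega
    · rw [hsq]
      exact ⟨by omega, by omega⟩
  have hfib : Y.card ≤ 4 * (Y.image fun x => corner k k' x false false).card := by
    refine card_le_mul_card_image _ _ fun y _ => ?_
    have hsub : (Y.filter fun x => corner k k' x false false = y) ⊆
        (univ : Finset (Bool × Bool)).image fun p => corner k k' y p.1 p.2 := by
      intro x hx
      refine mem_image.2 ⟨(x k, x k'), mem_univ _, ?_⟩
      rw [← (mem_filter.1 hx).2]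
      funext a
      simp only [corner, Function.update_apply]
      split_ifs with h1 h2
      · rw [h1]
      · rw [h2]
      · rfl
    exact (card_le_card hsub).trans (card_image_le.trans (by simp))
  have h9 : (Y.card : ℝ) ≤ 4 * (univ.filter P).card := by
    exact_mod_cast hfib.trans (Nat.mul_le_mul_left 4 (card_le_card hmaps))
  linarith

/-! ### Testers -/

theorem outputProb_eq {n : ℕ} (A : RandAlg n) (f : BoolFun n) :
    RandAlg.outputProb A f true = ∑' T, A T * (if T.output f = true then 1 else 0) := by
  classical
  rw [RandAlg.outputProb, PMF.map_apply]
  refine tsum_congr fun T => ?_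
  cases h : T.output f <;> simp

theorem outputProb_true_le {n : ℕ} (A : RandAlg n) (f : BoolFun n)
    (h : 2 / 3 ≤ RandAlg.outputProb A f false) : RandAlg.outputProb A f true ≤ 1 / 3 := by
  have h1 : RandAlg.outputProb A f true + RandAlg.outputProb A f false = 1 := by
    have := (A.map (DetAlg.output f)).tsum_coe
    rwa [tsum_fintype, Fintype.sum_bool] at this
  have h2 : RandAlg.outputProb A f true + 2 / 3 ≤ 1 / 3 + 2 / 3 := by
    refine (add_le_add_right h _).trans ?_
    rw [h1, ← ENNReal.add_div]
    norm_num
    rw [ENNReal.div_self] <;> norm_num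
  exact ENNReal.le_of_add_le_add_right (ENNReal.div_ne_top (by norm_num) (by norm_num)) h2

theorem sum_outputProb {n : ℕ} {Θ : Type*} (A : RandAlg n) (S : Finset Θ) (f : Θ → BoolFun n) :
    ∑ θ ∈ S, RandAlg.outputProb A (f θ) true =
      ∑' T : DetAlg n, A T * ((S.filter fun θ => T.output (f θ) = true).card : ℝ≥0∞) := by
  simp only [outputProb_eq]
  rw [← Summable.tsum_finsetSum fun θ _ => ENNReal.summable]
  refine tsum_congr fun T => ?_
  rw [← mul_sum, sum_boole]

/-- If the runs on two families of functions, one monotone and one far from monotone, can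
be distinguished by deterministic algorithms only on few members, there is no tester. -/
theorem card_le_of_tester {n q h : ℕ} {Θ : Type*} {A : RandAlg n} {ε : ℝ}
    (hA : RandAlg.IsMonotonicityTester A ε) (hq : RandAlg.MakesAtMost A q) (S : Finset Θ)
    (f g : Θ → BoolFun n) (hf : ∀ θ ∈ S, Monotone (f θ)) (hg : ∀ θ ∈ S, FarFromMonotone ε (g θ))
    (hT : ∀ T : DetAlg n, (∀ f, T.numQueries f ≤ q) →
      (S.filter fun θ => T.output (f θ) = true).card ≤
        (S.filter fun θ => T.output (g θ) = true).card + h) :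
    S.card ≤ 3 * h := by
  have h1 : (S.card : ℝ≥0∞) * (2 / 3) ≤ ∑ θ ∈ S, RandAlg.outputProb A (f θ) true := by
    rw [← nsmul_eq_mul]
    exact card_nsmul_le_sum _ _ _ fun θ hθ => hA.1 _ (hf θ hθ)
  have h2 : ∑ θ ∈ S, RandAlg.outputProb A (g θ) true ≤ (S.card : ℝ≥0∞) * (1 / 3) := by
    rw [← nsmul_eq_mul]
    exact sum_le_card_nsmul _ _ _ fun θ hθ => outputProb_true_le A _ (hA.2 _ (hg θ hθ))
  have h3 : ∑ θ ∈ S, RandAlg.outputProb A (f θ) true ≤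
      ∑ θ ∈ S, RandAlg.outputProb A (g θ) true + h := by
    rw [sum_outputProb, sum_outputProb]
    calc _ ≤ ∑' T : DetAlg n, (A T * ((S.filter fun θ => T.output (g θ) = true).card : ℝ≥0∞) +
          A T * h) := by
          refine ENNReal.tsum_le_tsum fun T => ?_
          by_cases hs : T ∈ A.support
          · rw [← mul_add]
            gcongr
            exact_mod_cast hT T (hq T hs)
          · rw [PMF.mem_support_iff, not_not] at hs
            simp [hs]
      _ = _ := by
          rw [ENNReal.tsum_add, ENNReal.tsum_mul_right, A.tsum_coe, one_mul]
  have h4 : (S.card : ℝ≥0∞) * (2 / 3) ≤ (S.card : ℝ≥0∞) * (1 / 3) + h :=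
    h1.trans (h3.trans (add_le_add_left h2 _))
  have h5 := ENNReal.toReal_mono (by
    refine ENNReal.add_ne_top.2 ⟨ENNReal.mul_ne_top (ENNReal.natCast_ne_top _)
      (ENNReal.div_ne_top (by norm_num) (by norm_num)), ENNReal.natCast_ne_top _⟩) h4
  rw [ENNReal.toReal_add (ENNReal.mul_ne_top (ENNReal.natCast_ne_top _)
      (ENNReal.div_ne_top (by norm_num) (by norm_num))) (ENNReal.natCast_ne_top _)] at h5
  simp only [ENNReal.toReal_mul, ENNReal.toReal_natCast, ENNReal.toReal_div,
    ENNReal.toReal_ofNat, ENNReal.toReal_one] at h5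
  have h6 : (S.card : ℝ) ≤ 3 * h := by linarith
  exact_mod_cast h6

section

variable {n M N L : ℕ} [NeZero M]

/-! ### No tester with few queries -/

-- Reverse Markov inequality: the mean density of good squares is at least κ^L/8, so density κ^L/16
-- is attained on at least a κ^L/16 fraction of the pairs (τ, k).
open Classical in
theorem card_pairs_ge {lo : ℕ} {κ : ℝ} (h4 : 2 * lo + 4 ≤ n) (hlo : 2 * n ≤ (n - 2 * lo - 4) ^ 2)
    (hκ0 : 0 ≤ κ) (hκ : κ ≤ N * ((1 - 1 / (M : ℝ)) ^ (n - lo) * (1 - (1 - 1 / (M : ℝ)) ^ lo) ^ N))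
    (π : Fin n → Fin n) :
    n * κ ^ L * Fintype.card (Terms n M N L) ≤
      16 * (univ.filter fun p : Terms n M N L × Fin n =>
        κ ^ L / 16 * 2 ^ n ≤ (goodBase lo p.1 p.2 (π p.2)).card).card := by
  set F := univ.filter fun p : Terms n M N L × Fin n =>
    κ ^ L / 16 * 2 ^ n ≤ (goodBase lo p.1 p.2 (π p.2)).card with hF
  have h2 : (0 : ℝ) < 2 ^ n := by positivity
  have hlow : ∀ k : Fin n, κ ^ L * Fintype.card (Terms n M N L) * (2 ^ n / 8) ≤
      ∑ τ : Terms n M N L, ((goodBase lo τ k (π k)).card : ℝ) := by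
    intro k
    refine le_trans ?_ (sum_card_goodBase_ge (by omega) k (π k))
    have := card_squares_ge h4 hlo k (π k) _ fun x => Iff.rfl
    exact mul_le_mul (mul_le_mul_of_nonneg_right (pow_le_pow_left₀ hκ0 hκ _) (Nat.cast_nonneg _))
      (by linarith) (by positivity)
      (mul_nonneg (pow_nonneg (hκ0.trans hκ) _) (Nat.cast_nonneg _))
  have htot : n * (κ ^ L * Fintype.card (Terms n M N L) * (2 ^ n / 8)) ≤
      ∑ p : Terms n M N L × Fin n, ((goodBase lo p.1 p.2 (π p.2)).card : ℝ) := by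
    rw [Fintype.sum_prod_type_right]
    refine le_trans (le_of_eq ?_) (sum_le_sum fun k _ => hlow k)
    simp
  have hup : ∑ p : Terms n M N L × Fin n, ((goodBase lo p.1 p.2 (π p.2)).card : ℝ) ≤
      F.card * 2 ^ n + Fintype.card (Terms n M N L) * n * (κ ^ L / 16 * 2 ^ n) := by
    calc _ ≤ ∑ p : Terms n M N L × Fin n,
          ((if p ∈ F then (2 : ℝ) ^ n else 0) + κ ^ L / 16 * 2 ^ n) := by
          refine sum_le_sum fun p _ => ?_
          split_ifs with hp
          · have h3 : ((goodBase lo p.1 p.2 (π p.2)).card : ℝ) ≤ 2 ^ n := by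
              have := card_le_univ (goodBase lo p.1 p.2 (π p.2))
              rw [Fintype.card_fun, Fintype.card_bool, Fintype.card_fin] at this
              exact_mod_cast this
            have : 0 ≤ κ ^ L / 16 * 2 ^ n := by positivity
            linarith
          · rw [hF, mem_filter, not_and, not_le] at hp
            rw [zero_add]
            exact (hp (mem_univ _)).le
      _ = _ := by
          rw [sum_add_distrib, sum_ite_mem, univ_inter, sum_const, sum_const, nsmul_eq_mul,
            nsmul_eq_mul, card_univ, Fintype.card_prod, Fintype.card_fin]
          push_cast
          ring
  refine le_of_mul_le_mul_right ?_ h2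
  linarith [htot.trans hup]

/-- A tester would force |F| ≤ 3 · 2K · |Terms|, where the 2 accounts for k and its successor, while
`card_pairs_ge` gives n κ^L |Terms| ≤ 16 |F|. This is the origin of 96 = 16 · 3 · 2. -/
theorem not_isMonotonicityTester {lo s t q : ℕ} {κ : ℝ} (h4 : 2 * lo + 4 ≤ n)
    (hlo : 2 * n ≤ (n - 2 * lo - 4) ^ 2) (hκ0 : 0 ≤ κ)
    (hκ : κ ≤ N * ((1 - 1 / (M : ℝ)) ^ (n - lo) * (1 - (1 - 1 / (M : ℝ)) ^ lo) ^ N))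
    (hL : 1 ≤ L) (hq : q ≤ t ^ L) (hδ : q * (1 - 1 / (M : ℝ)) ^ s ≤ 1 / 2)
    (hsmall : 96 * (((L * (2 * t * (n - 2 * lo + s) * q) : ℕ) : ℝ) +
      n * (4 * q ^ 2 * L * (1 - 1 / (M : ℝ)) ^ s)) < n * κ ^ L)
    {A : RandAlg n} (hA : RandAlg.MakesAtMost A q) :
    ¬ RandAlg.IsMonotonicityTester A (κ ^ L / 16) := by
  classical
  intro hT
  set K : ℝ := ((L * (2 * t * (n - 2 * lo + s) * q) : ℕ) : ℝ) +
      n * (4 * q ^ 2 * L * (1 - 1 / (M : ℝ)) ^ s) with hK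
  have hπ : ∀ k, finRotate n k ≠ k := fun k => by
    rw [← Equiv.Perm.mem_support, support_finRotate_of_le (by omega)]
    exact mem_univ _
  set F := univ.filter fun p : Terms n M N L × Fin n =>
    κ ^ L / 16 * 2 ^ n ≤ (goodBase lo p.1 p.2 (finRotate n p.2)).card with hF
  have hW : (0 : ℝ) < Fintype.card (Terms n M N L) := Nat.cast_pos.2 Fintype.card_pos
  have hB : (0 : ℝ) < Fintype.card (Bits N L) := Nat.cast_pos.2 Fintype.card_pos
  have hr : (0 : ℝ) ≤ 1 - 1 / (M : ℝ) := by
    have : (1 : ℝ) ≤ M := by exact_mod_cast NeZero.one_le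
    rw [sub_nonneg]
    exact div_le_one_of_le₀ this (by linarith)
  have hK0 : 0 ≤ K := by positivity
  have hH0 : 0 ≤ 2 * K * (Fintype.card (Terms n M N L) * Fintype.card (Bits N L)) := by positivity
  have key := card_le_of_tester hT hA (F ×ˢ (univ : Finset (Bits N L)))
    (fun p => yesFn lo p.1.1 p.2) (fun p => noFn lo p.1.1 p.2 p.1.2 (finRotate n p.1.2))
    (h := ⌊2 * K * (Fintype.card (Terms n M N L) * Fintype.card (Bits N L))⌋₊)
    (fun p _ => monotone_fn p.1.1 fun w => p.2 (enc L w))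
    (fun p hp => farFromMonotone_noFn (hπ _).symm (mem_filter.1 (mem_product.1 hp).1).2 _) ?_
  · rw [card_product, card_univ] at key
    have h1 : (F.card : ℝ) * Fintype.card (Bits N L) ≤
        3 * (2 * K * (Fintype.card (Terms n M N L) * Fintype.card (Bits N L))) := by
      have := Nat.floor_le hH0
      have key' : (F.card : ℝ) * Fintype.card (Bits N L) ≤
        3 * (⌊2 * K * (Fintype.card (Terms n M N L) * Fintype.card (Bits N L))⌋₊ : ℕ) := by
        exact_mod_cast key
      linarith
    have h2 : (F.card : ℝ) ≤ 6 * K * Fintype.card (Terms n M N L) := by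
      refine le_of_mul_le_mul_right ?_ hB
      linarith
    have h3 := card_pairs_ge (L := L) h4 hlo hκ0 hκ (finRotate n)
    have h4 := mul_lt_mul_of_pos_right hsmall hW
    rw [← hF] at h3
    linarith
  · intro T hT
    have hsplit : ∀ P : (Terms n M N L × Fin n) × Bits N L → Prop, ∀ _ : DecidablePred P,
        ((F ×ˢ (univ : Finset (Bits N L))).filter P).card =
          ∑ p ∈ F, (univ.filter fun b => P (p, b)).card := by
      intro P _
      simp only [card_filter, sum_product]
    rw [hsplit, hsplit]
    have hcaught := card_caught_le (N := N) (lo := lo) (T := T) (finRotate n) hL (by omega) hq hT hδ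
    rw [← hK, ← Fintype.sum_prod_type'] at hcaught
    refine (sum_le_sum fun p _ => card_yes_le_card_no lo p.1 p.2 (finRotate n p.2) T).trans ?_
    rw [sum_add_distrib]
    refine Nat.add_le_add_left (Nat.le_floor (le_trans ?_ hcaught)) _
    rw [Nat.cast_sum]
    exact sum_le_sum_of_subset_of_nonneg (subset_univ F) fun p _ _ => Nat.cast_nonneg _

end

/-! ### Choice of parameters -/

theorem exp_neg_two_mul_le {p : ℝ} (h0 : 0 ≤ p) (h1 : p ≤ 1 / 2) : Real.exp (-(2 * p)) ≤ 1 - p := by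
  rw [Real.exp_neg]
  refine inv_le_of_inv_le₀ (by linarith) ?_
  refine le_trans ?_ (Real.add_one_le_exp (2 * p))
  rw [inv_le_iff_one_le_mul₀ (by linarith)]
  nlinarith

theorem one_sub_inv_pow_le {M : ℕ} (hM : 1 ≤ M) (k : ℕ) :
    (1 - 1 / (M : ℝ)) ^ k ≤ Real.exp (-(k / M)) := by
  have hM' : (1 : ℝ) ≤ M := by exact_mod_cast hM
  calc (1 - 1 / (M : ℝ)) ^ k ≤ Real.exp (-(1 / M)) ^ k := by
        refine pow_le_pow_left₀ (sub_nonneg.2 (div_le_one_of_le₀ hM' (by linarith))) ?_ _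
        linarith [Real.add_one_le_exp (-(1 / (M : ℝ)))]
    _ = _ := by
        rw [← Real.exp_nat_mul]
        congr 1
        ring

/-- Take N about 1/p with p = (1 - 1/M)^lo, so that 1 ≤ N p ≤ 2. Then no other term is hit with
probability at least e^(-4), and the spread of the middle layers, at most 4M + 1, costs a factor at
least e^(-9). -/
theorem exists_width {M lo m : ℕ} (hM : 2 ≤ M) (hlo : M ≤ lo) (hm : m ≤ lo + (4 * M + 1)) :
    ∃ N : ℕ, Real.exp (-13) ≤
      N * ((1 - 1 / (M : ℝ)) ^ m * (1 - (1 - 1 / (M : ℝ)) ^ lo) ^ N) := by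
  have hM' : (2 : ℝ) ≤ M := by exact_mod_cast hM
  have hlo' : (M : ℝ) ≤ lo := by exact_mod_cast hlo
  have hinv : 1 / (M : ℝ) ≤ 1 / 2 := one_div_le_one_div_of_le (by norm_num) hM'
  have hinv0 : 0 < 1 / (M : ℝ) := by positivity
  set r : ℝ := 1 - 1 / (M : ℝ) with hr
  have hr0 : 0 < r := by linarith
  have hr1 : r ≤ 1 := by linarith
  set p := r ^ lo with hp
  have hp0 : 0 < p := by positivity
  have hp1 : p ≤ 1 / 2 := by
    refine (one_sub_inv_pow_le (by omega) lo).trans ?_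
    calc Real.exp (-(lo / M)) ≤ Real.exp (-1) := by
          refine Real.exp_le_exp.2 (neg_le_neg ?_)
          rwa [le_div_iff₀ (by linarith), one_mul]
      _ ≤ 1 / 2 := by
          rw [Real.exp_neg, ← one_div]
          exact one_div_le_one_div_of_le (by norm_num) (by linarith [Real.add_one_le_exp (1 : ℝ)])
  refine ⟨⌈p⁻¹⌉₊, ?_⟩
  set N := ⌈p⁻¹⌉₊ with hN
  have hN1 : 1 ≤ N * p := by
    have := Nat.le_ceil p⁻¹
    calc (1 : ℝ) = p⁻¹ * p := (inv_mul_cancel₀ hp0.ne').symm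
      _ ≤ N * p := by gcongr
  have hN2 : N * p ≤ 2 := by
    have := Nat.ceil_lt_add_one (inv_nonneg.2 hp0.le)
    calc N * p ≤ (p⁻¹ + 1) * p := by gcongr
      _ = 1 + p := by rw [add_mul, inv_mul_cancel₀ hp0.ne', one_mul]
      _ ≤ 2 := by linarith
  have h1 : Real.exp (-4) ≤ (1 - p) ^ N := by
    calc Real.exp (-4) ≤ Real.exp (N * -(2 * p)) := Real.exp_le_exp.2 (by linarith)
      _ = Real.exp (-(2 * p)) ^ N := Real.exp_nat_mul _ _
      _ ≤ _ := pow_le_pow_left₀ (Real.exp_pos _).le (exp_neg_two_mul_le hp0.le hp1) _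
  have h2 : Real.exp (-9) ≤ r ^ (4 * M + 1) := by
    calc Real.exp (-9) ≤ Real.exp ((4 * M + 1 : ℕ) * -(2 * (1 / (M : ℝ)))) := by
          refine Real.exp_le_exp.2 ?_
          push_cast
          have : (M : ℝ) * (1 / M) = 1 := by field_simp
          linarith
      _ = Real.exp (-(2 * (1 / (M : ℝ)))) ^ (4 * M + 1) := Real.exp_nat_mul _ _
      _ ≤ _ := pow_le_pow_left₀ (Real.exp_pos _).le (exp_neg_two_mul_le hinv0.le hinv) _
  have h3 : p * r ^ (4 * M + 1) ≤ r ^ m := by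
    rw [hp, ← pow_add]
    exact pow_le_pow_of_le_one hr0.le hr1 hm
  calc Real.exp (-13) = 1 * Real.exp (-9) * Real.exp (-4) := by
        rw [one_mul, ← Real.exp_add]
        norm_num
    _ ≤ (N * p) * r ^ (4 * M + 1) * (1 - p) ^ N := by
        have := Real.exp_pos (-4)
        have := Real.exp_pos (-9)
        gcongr
    _ = N * ((p * r ^ (4 * M + 1)) * (1 - p) ^ N) := by ring
    _ ≤ _ := by
        have : 0 ≤ (1 - p) ^ N := pow_nonneg (by linarith) _
        gcongr

open Filter Topology in
theorem eventually_parameters {a b δ : ℝ} (ha : 0 < a) (hb : 0 < b) (hδ : 0 < δ) :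
    ∀ᶠ n : ℕ in atTop, (n : ℝ) ^ (-b) < δ ∧ n * Real.exp (-((n : ℝ) ^ a)) < δ := by
  refine tendsto_natCast_atTop_atTop.eventually (p := fun x : ℝ =>
    x ^ (-b) < δ ∧ x * Real.exp (-(x ^ a)) < δ) ?_
  refine ((tendsto_rpow_neg_atTop hb).eventually_lt_const hδ).and ?_
  have h := (tendsto_rpow_mul_exp_neg_mul_atTop_nhds_zero (1 / a) 1 one_pos).comp
    (tendsto_rpow_atTop ha)
  filter_upwards [h.eventually_lt_const hδ, eventually_ge_atTop 0] with x hx hx0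
  rwa [Function.comp_apply, ← Real.rpow_mul hx0, mul_one_div_cancel ha.ne', Real.rpow_one,
    neg_one_mul] at hx

theorem exists_eps_forall_tester {c : ℝ} (hc0 : 0 < c) (hc : c ≤ 1 / 4) :
    ∃ ε : ℝ, 0 < ε ∧ ∃ n₀ : ℕ, ∀ n : ℕ, n₀ ≤ n → ∀ (A : RandAlg n) (q : ℕ),
      RandAlg.IsMonotonicityTester A ε → RandAlg.MakesAtMost A q →
        (n : ℝ) ^ ((1 : ℝ) / 2 - c) ≤ (q : ℝ) := by
  obtain ⟨L, hL⟩ := exists_nat_gt (1 / c)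
  have hL0 : (0 : ℝ) < L := (one_div_pos.2 hc0).trans hL
  have hL1 : 1 ≤ L := by exact_mod_cast hL0
  have hLc : 1 < L * c := by rwa [div_lt_iff₀ hc0] at hL
  set a : ℝ := (1 / 2 - c) / L with ha
  have haL : a * L = 1 / 2 - c := by rw [ha]; field_simp
  have ha0 : 0 < a := div_pos (by linarith) hL0
  -- This is where the depth matters: 2aL = 1 - 2c < 1 < Lc.
  have hb : 0 < c - 2 * a := by
    have h1 : L * (2 * a) < L * c := by linarith
    linarith [lt_of_mul_lt_mul_left h1 hL0.le]
  set κ : ℝ := Real.exp (-13) with hκ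
  have hκ0 : 0 < κ := Real.exp_pos _
  -- The factor 96 comes from `not_isMonotonicityTester`; 100 leaves room for the constants 48 and 4
  -- of the two error terms.
  have hδ : 0 < min (1 / 2) (κ ^ L / (96 * 100 * L)) := by positivity
  obtain ⟨n₁, hn₁⟩ := Filter.eventually_atTop.1 (eventually_parameters ha0 hb hδ)
  refine ⟨κ ^ L / 16, by positivity, max n₁ 100, fun n hn A q hA hq => ?_⟩
  by_contra! hlt
  obtain ⟨e1, e2⟩ := hn₁ n (le_of_max_le_left hn)
  have hn100 : 100 ≤ n := le_of_max_le_right hn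
  have hnR : (100 : ℝ) ≤ n := by exact_mod_cast hn100
  have hn0 : (0 : ℝ) < n := by linarith
  obtain ⟨M, hM⟩ : ∃ M, M = Nat.sqrt n := ⟨_, rfl⟩
  have hM10 : 10 ≤ M := by
    rw [hM, Nat.le_sqrt]
    omega
  have hMn : M * M ≤ n := hM ▸ Nat.sqrt_le n
  have hnM : n < (M + 1) * (M + 1) := hM ▸ Nat.lt_succ_sqrt n
  have : NeZero M := ⟨by omega⟩
  have hMR : (10 : ℝ) ≤ M := by exact_mod_cast hM10
  have hMn' : (M : ℝ) ≤ (n : ℝ) ^ (1 / 2 : ℝ) := by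
    rw [← Real.sqrt_eq_rpow]
    refine Real.le_sqrt_of_sq_le ?_
    rw [pow_two]
    exact_mod_cast hMn
  have h10 : 10 * M ≤ n := (Nat.mul_le_mul_right M hM10).trans hMn
  obtain ⟨lo, hlo⟩ : ∃ lo, lo = n / 2 - 2 * M := ⟨_, rfl⟩
  obtain ⟨N, hN⟩ := exists_width (M := M) (lo := lo) (m := n - lo) (by omega) (by omega) (by omega)
  set t := ⌈(n : ℝ) ^ a⌉₊ with ht
  have hna : 1 ≤ (n : ℝ) ^ a := Real.one_le_rpow (by linarith) ha0.le
  have ht1 : (n : ℝ) ^ a ≤ t := Nat.le_ceil _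
  have ht2 : (t : ℝ) ≤ 2 * (n : ℝ) ^ a := by
    have := Nat.ceil_lt_add_one (zero_le_one.trans hna)
    linarith
  have htR : (1 : ℝ) ≤ t := hna.trans ht1
  have htpos : 1 ≤ t := by exact_mod_cast htR
  have hqn : (q : ℝ) ^ 2 ≤ n := by
    have h1 : (q : ℝ) ≤ (n : ℝ) ^ (1 / 2 : ℝ) :=
      hlt.le.trans (Real.rpow_le_rpow_of_exponent_le (by linarith) (by linarith))
    rw [← Real.sqrt_eq_rpow] at h1
    exact (Real.le_sqrt (by positivity) (by positivity)).1 h1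
  have hr0 : (0 : ℝ) ≤ 1 - 1 / (M : ℝ) :=
    sub_nonneg.2 (div_le_one_of_le₀ (by linarith) (by linarith))
  have hrs : (1 - 1 / (M : ℝ)) ^ (M * t) ≤ Real.exp (-((n : ℝ) ^ a)) := by
    refine (one_sub_inv_pow_le (by omega) _).trans (Real.exp_le_exp.2 (neg_le_neg ?_))
    push_cast
    rwa [mul_div_cancel_left₀ _ (by positivity)]
  have hq2 : (q : ℝ) ^ 2 * (1 - 1 / (M : ℝ)) ^ (M * t) ≤ n * Real.exp (-((n : ℝ) ^ a)) := by
    gcongr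
  -- The choice s = M t makes (1 - 1/M)^s at most exp(-n^a), at the price of one more factor t in
  -- the number of varying coordinates.
  refine not_isMonotonicityTester (M := M) (N := N) (L := L) (lo := lo) (s := M * t) (t := t)
    (κ := κ) (by omega) ?_ hκ0.le hN hL1 ?_ ?_ ?_ hq hA
  · have h1 : 4 * M - 4 ≤ n - 2 * lo - 4 := by omega
    refine le_trans ?_ (Nat.pow_le_pow_left h1 2)
    obtain ⟨m, rfl⟩ := Nat.exists_eq_add_of_le hM10
    rw [show 4 * (10 + m) - 4 = 36 + 4 * m by omega]
    nlinarith
  · have h1 : (q : ℝ) ≤ (t : ℝ) ^ L := by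
      calc (q : ℝ) ≤ (n : ℝ) ^ ((1 : ℝ) / 2 - c) := hlt.le
        _ = ((n : ℝ) ^ a) ^ L := by rw [← Real.rpow_natCast, ← Real.rpow_mul hn0.le, haL]
        _ ≤ _ := by gcongr
    exact_mod_cast h1
  · have h1 : (q : ℝ) ≤ (q : ℝ) ^ 2 := by exact_mod_cast Nat.le_self_pow two_ne_zero q
    calc (q : ℝ) * (1 - 1 / (M : ℝ)) ^ (M * t) ≤ (q : ℝ) ^ 2 * (1 - 1 / (M : ℝ)) ^ (M * t) := by
          gcongr
      _ ≤ _ := hq2.trans (e2.le.trans (min_le_left _ _))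
  · have e1' := e1.trans_le (min_le_right _ _)
    have e2' := e2.trans_le (min_le_right _ _)
    have h6 : ((n - 2 * lo + M * t : ℕ) : ℝ) ≤ 6 * M * t := by
      have h1 : n - 2 * lo + M * t ≤ 6 * M * t := by
        have h2 : n - 2 * lo ≤ 5 * M := by omega
        have h3 : M ≤ M * t := Nat.le_mul_of_pos_right M htpos
        calc n - 2 * lo + M * t ≤ 5 * (M * t) + M * t := by omega
          _ = _ := by ring
      exact_mod_cast h1
    have hK1 : ((L * (2 * t * (n - 2 * lo + M * t) * q) : ℕ) : ℝ) ≤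
        L * (48 * (n * (n : ℝ) ^ (-(c - 2 * a)))) := by
      rw [Nat.cast_mul, Nat.cast_mul, Nat.cast_mul, Nat.cast_mul]
      refine mul_le_mul_of_nonneg_left ?_ hL0.le
      calc ((2 : ℕ) : ℝ) * t * ((n - 2 * lo + M * t : ℕ) : ℝ) * q
          ≤ 2 * t * (6 * M * t) * q := by gcongr; norm_num
        _ ≤ 2 * (2 * (n : ℝ) ^ a) * (6 * (n : ℝ) ^ (1 / 2 : ℝ) * (2 * (n : ℝ) ^ a)) *
            (n : ℝ) ^ ((1 : ℝ) / 2 - c) := by gcongr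
        _ = 48 * ((n : ℝ) ^ a * (n : ℝ) ^ (1 / 2 : ℝ) * (n : ℝ) ^ a *
            (n : ℝ) ^ ((1 : ℝ) / 2 - c)) := by ring
        _ = _ := by
          rw [← Real.rpow_add hn0, ← Real.rpow_add hn0, ← Real.rpow_add hn0]
          nth_rewrite 2 [← Real.rpow_one (n : ℝ)]
          rw [← Real.rpow_add hn0]
          congr 2
          ring
    have hden : (0 : ℝ) < 96 * 100 * L := by positivity
    rw [lt_div_iff₀ hden] at e1' e2'
    have f1 : (n : ℝ) * ((n : ℝ) ^ (-(c - 2 * a)) * (96 * 100 * L)) < n * κ ^ L :=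
      mul_lt_mul_of_pos_left e1' hn0
    have f2 : (n : ℝ) * ((q : ℝ) ^ 2 * (1 - 1 / (M : ℝ)) ^ (M * t) * (96 * 100 * L)) < n * κ ^ L :=
      mul_lt_mul_of_pos_left (lt_of_le_of_lt (by gcongr) e2') hn0
    have g1 : 0 ≤ L * (n * (n : ℝ) ^ (-(c - 2 * a))) := by positivity
    have g2 : 0 ≤ L * (n * ((q : ℝ) ^ 2 * (1 - 1 / (M : ℝ)) ^ (M * t))) := by positivity
    linarith

end Talagrand

theorem theorem1 :
    (∀ c : ℝ, 0 < c →
      ∃ ε : ℝ, 0 < ε ∧ ∃ C : ℝ, 0 < C ∧ ∃ n₀ : ℕ, ∀ n : ℕ, n₀ ≤ n →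
        ∀ (A : RandAlg n) (q : ℕ), RandAlg.IsMonotonicityTester A ε → RandAlg.MakesAtMost A q →
          C * (n : ℝ) ^ ((1 : ℝ) / 2 - c) ≤ (q : ℝ)) ∧
    (∀ ℓ : ℕ, 1 ≤ ℓ →
      ∃ ε : ℝ, 0 < ε ∧ ∃ C : ℝ, 0 < C ∧ ∃ k n₀ : ℕ, ∀ n : ℕ, n₀ ≤ n →
        ∀ (A : RandAlg n) (q : ℕ), RandAlg.IsMonotonicityTester A ε → RandAlg.MakesAtMost A q →
          C * (n : ℝ) ^ ((1 : ℝ) / 2 - 1 / (4 * (ℓ : ℝ) + 2)) / Real.log (n : ℝ) ^ k ≤ (q : ℝ)) := by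
  have main : ∀ c : ℝ, 0 < c →
      ∃ ε : ℝ, 0 < ε ∧ ∃ n₀ : ℕ, ∀ n : ℕ, n₀ ≤ n →
        ∀ (A : RandAlg n) (q : ℕ), RandAlg.IsMonotonicityTester A ε → RandAlg.MakesAtMost A q →
          (n : ℝ) ^ ((1 : ℝ) / 2 - c) ≤ (q : ℝ) := by
    intro c hc
    -- Capping c at 1/4 keeps the exponent 1/2 - c positive; for larger c the bound only gets weaker
    -- once n ≥ 1.
    obtain ⟨ε, hε, n₀, h⟩ := Talagrand.exists_eps_forall_tester (c := min c (1 / 4))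
      (by positivity) (min_le_right _ _)
    refine ⟨ε, hε, max n₀ 1, fun n hn A q hA hq =>
      le_trans ?_ (h n (le_of_max_le_left hn) A q hA hq)⟩
    have hn1 : (1 : ℝ) ≤ n := by exact_mod_cast le_of_max_le_right hn
    exact Real.rpow_le_rpow_of_exponent_le hn1 (by linarith [min_le_left c (1 / 4)])
  refine ⟨fun c hc => ?_, fun ℓ _ => ?_⟩
  · obtain ⟨ε, hε, n₀, h⟩ := main c hc
    exact ⟨ε, hε, 1, one_pos, n₀, by simpa only [one_mul] using h⟩
  -- The power of the logarithm is k = 0.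
  · obtain ⟨ε, hε, n₀, h⟩ := main (1 / (4 * (ℓ : ℝ) + 2)) (by positivity)
    exact ⟨ε, hε, 1, one_pos, 0, n₀, by simpa only [one_mul, pow_zero, div_one] using h⟩
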